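/- Let $0<\alpha_1<\alpha_2<2$ and $c_1,c_2>0$. For $j=1,2$ let $G_j$ be a distribution in the domain of normal attraction of the stable law with characteristic function $\exp(-c_j|t|^{\alpha_j})$: if $Z_1,Z_2,\dots$ are i.i.d. with distribution $G_j$, then $n^{-1/\alpha_j}\big(Z_1+\dots+Z_n-d_j(n)\big)$ converges in distribution to this law, for some real constants $d_j(n)$ which are all $0$ if $\alpha_j\neq 1$. Let $X_1,X_2,\dots$ be independent random variables, each of which is assigned a type $j\in\{1,2\}$ and has distribution $G_j$ if it is of type $j$. Put $S_n=X_1+\dots+X_n$, and let $\tau_j(n)$ be the number of variables of type $j$ among $X_1,\dots,X_n$. Assume that $\tau_j(n)\to\infty$ for $j=1,2$ and that $$\frac{\tau_1(n)^{\alpha_2}}{\tau_2(n)^{\alpha_1}}\longrightarrow\lambda\in[0,\infty].$$ Let $(B_n)$ be a real sequence such that, as $n\to\infty$, $B_n/\tau_1(n)^{1/\alpha_1}$ (if $\lambda=\infty$), respectively $B_n/\tau_2(n)^{1/\alpha_2}$ (if $\lambda<\infty$), tends to a constant in $(0,\infty)$. Let $f>0$ be a nondecreasing function on $[1,\infty)$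 such that $\limsup_n f(b_n)/f(n)<\infty$ for every sequence $(b_n)$ of positive integers with $\limsup_n b_n/n<\infty$. Let $(a_n)$ be a sequence of positive-integer-valued random variables that is independent of the sequence $(X_k)$. Consider the conditions - $(C_1^*)$ $\limsup_n a_n/\tau_1(n)<\infty$ almost surely; - $(C_2^*)$ $\limsup_n a_n/n<\infty$ almost surely; - $(C_3)$ for some $\mu>\frac{\alpha_2-\alpha_1}{\alpha_2}$, $\tau_1(n)<n^{\alpha_1/\alpha_2}(\log n)^{-\mu}$ for all sufficiently large $n$. (i) If either $0<\lambda<\infty$ and $(C_2^*)$ holds, or $\lambda=\infty$ and $(C_1^*)$ holds, then with probability one $$\limsup_{n\to\infty}\frac{|S_{n+a_n}|}{B_n f(n)^{1/\alpha_1}}=0\ \text{ or }\ \infty\quad\text{according as}\quad\int_1^\infty\frac{dx}{x f(x)}<\infty\ \text{ or }\ =\infty .$$ (ii) If $\lambda=0$ and $(C_2^*)$ and $(C_3)$ hold, then with probability one $$\limsup_{n\to\infty}\frac{|S_{n+a_n}|}{B_n f(n)^{1/\alpha_2}}=0\ \text{ or }\ \infty\quad\text{according as}\quad\int_1^\infty\frac{dx}{x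 f(x)}<\infty\ \text{ or }\ =\infty .$$ -/

import Mathlib

open MeasureTheory ProbabilityTheory Filter Topology
open scoped ENNReal

namespace DelayedSums

/-- `ν` is the symmetric stable law with characteristic function `t ↦ exp (-c |t| ^ α)`. -/
def IsStableLaw (ν : ProbabilityMeasure ℝ) (α c : ℝ) : Prop :=
  ∀ t : ℝ, charFun (ν : Measure ℝ) t = Complex.exp ((-(c * |t| ^ α) : ℝ) : ℂ)

/-- The law of `(Z₁ + ⋯ + Z_n - d) / n ^ (1 / α)`, where `Z₁, …, Z_n` are independent with
common law `G`. -/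
noncomputable def normedSumLaw (G : ProbabilityMeasure ℝ) (α d : ℝ) (n : ℕ) :
    ProbabilityMeasure ℝ :=
  (ProbabilityMeasure.pi (fun _ : Fin n => G)).map
    (f := fun z : Fin n → ℝ => ((∑ i, z i) - d) / (n : ℝ) ^ (1 / α))
    (Measurable.aemeasurable (by fun_prop))

/-- `G` is in the domain of normal attraction of the stable law with characteristic function
`exp (-c |t| ^ α)`, with centering constants `d n`: the sums of `n` independent variables with
law `G`, centered by `d n` and divided by `n ^ (1 / α)`, converge in distribution to that law. -/
def InDomainOfNormalAttraction (G : ProbabilityMeasure ℝ) (α c : ℝ) (d : ℕ → ℝ) : Prop :=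
  ∃ ν : ProbabilityMeasure ℝ, IsStableLaw ν α c ∧
    Tendsto (fun n : ℕ => normedSumLaw G α (d n) n) atTop (𝓝 ν)

/-- The number of the first `n` summands that are of type `j`. -/
def tau (s : ℕ → Fin 2) (j : Fin 2) (n : ℕ) : ℕ :=
  ((Finset.range n).filter (fun k => s k = j)).card

/-- `u n ∼ v n` in the sense that `u n / v n` tends to a constant in `(0, ∞)`. -/
def SameOrder (u v : ℕ → ℝ) : Prop :=
  ∃ C : ℝ, 0 < C ∧ Tendsto (fun n => u n / v n) atTop (𝓝 C)

/-- The upper limit, in the extended reals, of a real sequence. -/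
noncomputable def limsupE (u : ℕ → ℝ) : EReal :=
  limsup (fun n => (u n : EReal)) atTop

/-- The partial sum of the first `n` summands (`X k` is the `(k+1)`-st summand). -/
noncomputable def partialSum {Ω : Type*} (X : ℕ → Ω → ℝ) (n : ℕ) (ω : Ω) : ℝ :=
  ∑ k ∈ Finset.range n, X k ω

/-- `∫_1^∞ dx / (x f(x))`, as an element of `[0, ∞]`. -/
noncomputable def logIntegral (f : ℝ → ℝ) : ℝ≥0∞ :=
  ∫⁻ x in Set.Ioi (1 : ℝ), ENNReal.ofReal (1 / (x * f x))

/-- Almost surely, `limsup |S_{n + a_n}| / (B_n f(n) ^ (1 / β))` is `0` or `∞` according as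
`∫_1^∞ dx / (x f(x))` is finite or infinite. -/
def ZeroInfinityLaw {Ω : Type*} [MeasurableSpace Ω] (P : Measure Ω) (X : ℕ → Ω → ℝ)
    (a : ℕ → Ω → ℕ) (B : ℕ → ℝ) (f : ℝ → ℝ) (β : ℝ) : Prop :=
  (logIntegral f < ⊤ →
    ∀ᵐ ω ∂P, limsupE (fun n =>
      |partialSum X (n + a n ω) ω| / (B n * f (n : ℝ) ^ (1 / β))) = 0) ∧
  (logIntegral f = ⊤ →
    ∀ᵐ ω ∂P, limsupE (fun n =>
      |partialSum X (n + a n ω) ω| / (B n * f (n : ℝ) ^ (1 / β))) = ⊤)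

end DelayedSums

/-! Let p be the type that governs the norming, so that B_n is of order τ_p(n)^(1/α), and let q be
the other type, with exponent α'. Here p is the first type if λ > 0 and the second if λ = 0. The
principle is that of a single large jump: a sum of N variables with law G exceeds a level x well
above N^(1/α) essentially only if one summand does, so with probability of order N x^(-α). This
needs tails of exact order x^(-α), and attraction to the stable law gives both directions. Tightness
together with `min_le_measureReal_lt_abs` gives the upper one
(`InDomainOfNormalAttraction.tail_le`), convergence of characteristic functions the lower one
(`InDomainOfNormalAttraction.le_tail`). Truncation and Chebyshev's inequality then give the upper
bound for sums (`exists_sumBound`), with mean zero when α > 1 and a logarithmic side condition when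
α = 1.

Convergence half (`ae_limsupE_eq_zero`): the indices n are grouped by k = ⌊log₂ τ_p(n)⌋. The lag
condition bounds both type counts at n + b_n in terms of k, so Etemadi's inequality leaves one
probability per k. Type p contributes a multiple of 1 / f(2^k), which is summable. Since f(2^k) ≥ k
eventually, type q contributes at most a multiple of k^(-(μ + α'/α)). For λ > 0 the ratio α'/α
exceeds 1 and μ = 0 suffices; for λ = 0 it is below 1, and (C₃) supplies the missing power of the
logarithm.

Divergence half (`ae_limsupE_eq_top`): indices n_k with τ_p(n_k) growing geometrically are chosen so
sparse that the blocks from n_k + b(n_k) to n_{k+1} + b(n_{k+1}) contain many variables of type p.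
Everything else in a block is an independent remainder, which cannot systematically cancel a large
jump. So the block sum is large with probability at least a constant times 1 / f(n_{k+1}). These
probabilities have infinite sum, the blocks are independent, and a large increment forces one of its
two end sums to be large.

Random lags independent of the summands reduce to deterministic ones by Fubini
(`ae_limsupE_random_lag`). -/

namespace DelayedSums

/-! ### Single large jumps and Etemadi's inequality -/

/-- If `D` is the sum of each `X i` (`i ∈ A`) and an independent remainder, then one large `X i`
makes `D` large. -/
theorem min_le_measureReal_lt_abs {ι Ω : Type*} [MeasurableSpace Ω] {P : Measure Ω}
    [IsProbabilityMeasure P] {X : ι → Ω → ℝ} {D : Ω → ℝ} (A : Finset ι)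
    (hX : ∀ i ∈ A, Measurable (X i)) (hD : Measurable D)
    (hpair : ∀ i ∈ A, ∀ j ∈ A, i ≠ j → IndepFun (X i) (X j) P)
    (hrest : ∀ i ∈ A, IndepFun (X i) (fun ω => D ω - X i ω) P) {y p : ℝ}
    (hp : ∀ i ∈ A, P.real {ω | 4 * y < |X i ω|} = p)
    (hq : ∀ i ∈ A, P.real {ω | 2 * y < |X i ω|} ≤ 1 / 4) (hAp : A.card * p ≤ 1 / 8) :
    min (1 / 2) (A.card * p / 8) ≤ P.real {ω | y < |D ω|} := by
  classical
  by_cases h : 1 / 2 ≤ P.real {ω | y < |D ω|}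
  · exact (min_le_left _ _).trans h
  push Not at h
  refine (min_le_right _ _).trans ?_
  set E : ι → Set Ω := fun i => {ω | 4 * y < |X i ω|} with hE
  set G : ι → Set Ω := fun i => {ω | |D ω - X i ω| ≤ 3 * y} with hG
  have hmE : ∀ i ∈ A, MeasurableSet (E i) := fun i hi =>
    measurableSet_lt measurable_const (hX i hi).abs
  have hmG : ∀ i ∈ A, MeasurableSet (G i) := fun i hi =>
    measurableSet_le (hD.sub (hX i hi)).abs measurable_const
  -- On `F i` the jump at `i` is the only one and the remainder is at most `3 * y`, so `|D| > y`.
  -- The sets `F i` are disjoint, so their probabilities add up.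
  set F : ι → Set Ω := fun i => (E i ∩ G i) \ ⋃ j ∈ A.erase i, E j with hF
  have hmF : ∀ i ∈ A, MeasurableSet (F i) := fun i hi =>
    ((hmE i hi).inter (hmG i hi)).diff
      (Finset.measurableSet_biUnion _ fun j hj => hmE j (Finset.mem_of_mem_erase hj))
  have hDle : 1 / 2 ≤ P.real {ω | |D ω| ≤ y} := by
    have : {ω | |D ω| ≤ y} = {ω | y < |D ω|}ᶜ := by ext; simp
    rw [this, probReal_compl_eq_one_sub (measurableSet_lt measurable_const hD.abs)]
    linarith
  -- With probability at least 1/2 the whole sum is at most `y`, and `X i` exceeds `2 * y` with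
  -- probability at most 1/4. The remainder is thus controlled without any centering or symmetry.
  have hGi : ∀ i ∈ A, 1 / 4 ≤ P.real (G i) := by
    intro i hi
    have hsub : {ω | |D ω| ≤ y} ⊆ G i ∪ {ω | 2 * y < |X i ω|} := by
      intro ω hω
      by_cases h2 : 2 * y < |X i ω|
      · exact Or.inr h2
      · left
        simp only [Set.mem_ofPred_eq, not_lt, hG] at *
        linarith [abs_sub (D ω) (X i ω)]
    have := (measureReal_mono hsub (measure_ne_top P _)).trans (measureReal_union_le _ _)
    linarith [hq i hi]
  have hp0 : ∀ i ∈ A, 0 ≤ p := fun i hi => (hp i hi) ▸ measureReal_nonneg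
  have hFi : ∀ i ∈ A, p / 8 ≤ P.real (F i) := by
    intro i hi
    have hEG : P.real (E i ∩ G i) = P.real (E i) * P.real (G i) := by
      have := (hrest i hi).measure_inter_preimage_eq_mul {z | 4 * y < |z|} {z | |z| ≤ 3 * y}
        (measurableSet_lt measurable_const measurable_id.abs)
        (measurableSet_le measurable_id.abs measurable_const)
      rw [measureReal_def, measureReal_def, measureReal_def, ← ENNReal.toReal_mul]
      exact congrArg ENNReal.toReal this
    have hEE : ∀ j ∈ A.erase i, P.real (E i ∩ E j) = p * p := by
      intro j hj
      have hj' := Finset.mem_of_mem_erase hj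
      have := (hpair i hi j hj' (Finset.ne_of_mem_erase hj).symm).measure_inter_preimage_eq_mul
        {z | 4 * y < |z|} {z | 4 * y < |z|}
        (measurableSet_lt measurable_const measurable_id.abs)
        (measurableSet_lt measurable_const measurable_id.abs)
      have h3 : P.real (E i ∩ E j) = P.real (E i) * P.real (E j) := by
        rw [measureReal_def, measureReal_def, measureReal_def, ← ENNReal.toReal_mul]
        exact congrArg ENNReal.toReal this
      rw [h3, hp i hi, hp j hj']
    have hsub : E i ∩ G i ⊆ F i ∪ ⋃ j ∈ A.erase i, (E i ∩ E j) := by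
      intro ω hω
      by_cases h2 : ω ∈ ⋃ j ∈ A.erase i, E j
      · right
        simp only [Set.mem_iUnion] at h2 ⊢
        obtain ⟨j, hj, hj2⟩ := h2
        exact ⟨j, hj, hω.1, hj2⟩
      · exact Or.inl ⟨hω, h2⟩
    have h1 := (measureReal_mono hsub (measure_ne_top P _)).trans (measureReal_union_le _ _)
    have h2 := measureReal_biUnion_finset_le (μ := P) (A.erase i) (fun j => E i ∩ E j)
    rw [Finset.sum_congr rfl hEE, Finset.sum_const, nsmul_eq_mul] at h2
    have h3 : ((A.erase i).card : ℝ) * (p * p) ≤ 1 / 8 * p := by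
      rw [← mul_assoc]
      refine mul_le_mul_of_nonneg_right (le_trans ?_ hAp) (hp0 i hi)
      exact mul_le_mul_of_nonneg_right (by exact_mod_cast Finset.card_erase_le) (hp0 i hi)
    rw [hEG, hp i hi] at h1
    -- At least `p / 4` comes from independence of jump and remainder; a second jump costs at most
    -- `p / 8`.
    nlinarith [hGi i hi, hp0 i hi]
  have hsub : (⋃ i ∈ A, F i) ⊆ {ω | y < |D ω|} := by
    intro ω hω
    simp only [Set.mem_iUnion] at hω
    obtain ⟨i, hi, ⟨h1, h2⟩, -⟩ := hω
    simp only [Set.mem_ofPred_eq, hE, hG] at *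
    have := abs_sub_abs_le_abs_sub (X i ω) (X i ω - D ω)
    rw [sub_sub_cancel, abs_sub_comm (X i ω)] at this
    linarith
  have hdisj : (A : Set ι).PairwiseDisjoint F := by
    intro i hi j hj hij
    refine Set.disjoint_left.2 fun ω h1 h2 => h2.2 ?_
    simp only [Set.mem_iUnion]
    exact ⟨i, Finset.mem_erase.2 ⟨hij, hi⟩, h1.1.1⟩
  calc (A.card : ℝ) * p / 8 = ∑ i ∈ A, p / 8 := by simp [mul_div_assoc]
    _ ≤ ∑ i ∈ A, P.real (F i) := Finset.sum_le_sum hFi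
    _ = P.real (⋃ i ∈ A, F i) := (measureReal_biUnion_finset hdisj hmF).symm
    _ ≤ _ := measureReal_mono hsub (measure_ne_top P _)

theorem measurable_partialSum {Ω : Type*} [MeasurableSpace Ω] {X : ℕ → Ω → ℝ}
    (hX : ∀ k, Measurable (X k)) (m : ℕ) : Measurable (partialSum X m) :=
  Finset.measurable_sum _ fun k _ => hX k

/-- Etemadi's maximal inequality. -/
theorem measureReal_exists_lt_abs_partialSum_le {Ω : Type*} [MeasurableSpace Ω] {P : Measure Ω}
    [IsProbabilityMeasure P] {X : ℕ → Ω → ℝ} (hX : ∀ k, Measurable (X k)) (hind : iIndepFun X P)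
    (M : ℕ) {x q : ℝ} (hq : ∀ m ≤ M, P.real {ω | x < |partialSum X m ω|} ≤ q) :
    P.real {ω | ∃ m ≤ M, 3 * x < |partialSum X m ω|} ≤ 3 * q := by
  set S := partialSum X with hS
  have hSm : ∀ m, Measurable (S m) := measurable_partialSum hX
  -- First passage above `3 * x` at time `m`. Either the final sum exceeds `x`, or the later
  -- increment exceeds `2 * x`, and that increment is independent of the past.
  set E : ℕ → Set Ω := fun m => {ω | 3 * x < |S m ω|} ∩ ⋂ j ∈ Finset.range m, {ω | |S j ω| ≤ 3 * x}
    with hE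
  set V : ℕ → Set Ω := fun m => {ω | 2 * x < |S M ω - S m ω|} with hV
  have hEm : ∀ m, MeasurableSet (E m) := fun m =>
    (measurableSet_lt measurable_const (hSm m).abs).inter
      (Finset.measurableSet_biInter _ fun j _ => measurableSet_le (hSm j).abs measurable_const)
  have hindep : ∀ m ≤ M, P.real (E m ∩ V m) = P.real (E m) * P.real (V m) := by
    intro m hm
    have hI : Indep (⨆ k ∈ {k | k < m}, MeasurableSpace.comap (X k) inferInstance)
        (⨆ k ∈ {k | m ≤ k}, MeasurableSpace.comap (X k) inferInstance) P :=
      indep_iSup_of_disjoint (fun k => (hX k).comap_le) hind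
        (Set.disjoint_left.2 fun k h1 h2 => by simp at h1 h2; omega)
    have hXk : ∀ (T : Set ℕ) (k : ℕ), k ∈ T →
        Measurable[⨆ k ∈ T, MeasurableSpace.comap (X k) inferInstance] (X k) := by
      intro T k hk
      exact (comap_measurable (X k)).mono
        (le_iSup₂ (f := fun k (_ : k ∈ T) => MeasurableSpace.comap (X k) inferInstance) k hk) le_rfl
    have h1 : MeasurableSet[⨆ k ∈ {k | k < m}, MeasurableSpace.comap (X k) inferInstance] (E m) := by
      have hSj : ∀ j ≤ m,
          Measurable[⨆ k ∈ {k | k < m}, MeasurableSpace.comap (X k) inferInstance] (S j) := by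
        intro j hj
        refine Finset.measurable_sum _ fun k hk => hXk _ k ?_
        exact lt_of_lt_of_le (Finset.mem_range.1 hk) hj
      have hlt : MeasurableSet {z : ℝ | 3 * x < |z|} :=
        measurableSet_lt measurable_const measurable_id.abs
      have hle : MeasurableSet {z : ℝ | |z| ≤ 3 * x} :=
        measurableSet_le measurable_id.abs measurable_const
      exact MeasurableSet.inter (hSj m le_rfl hlt) <| Finset.measurableSet_biInter _ fun j hj =>
        hSj j (Finset.mem_range.1 hj).le hle
    have h2 : MeasurableSet[⨆ k ∈ {k | m ≤ k}, MeasurableSpace.comap (X k) inferInstance] (V m) := by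
      have : (fun ω => S M ω - S m ω) = fun ω => ∑ k ∈ Finset.Ico m M, X k ω := by
        funext ω
        simp [hS, partialSum, Finset.sum_Ico_eq_sub _ hm]
      have hT : Measurable[⨆ k ∈ {k | m ≤ k}, MeasurableSpace.comap (X k) inferInstance]
          (fun ω => S M ω - S m ω) := by
        rw [this]
        exact Finset.measurable_sum _ fun k hk => hXk _ k (Finset.mem_Ico.1 hk).1
      have hlt : MeasurableSet {z : ℝ | 2 * x < |z|} :=
        measurableSet_lt measurable_const measurable_id.abs
      exact hT hlt
    rw [measureReal_def, measureReal_def, measureReal_def, ← ENNReal.toReal_mul]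
    exact congrArg ENNReal.toReal ((Indep_iff _ _ P).1 hI _ _ h1 h2)
  have hq0 : 0 ≤ q := measureReal_nonneg.trans (hq 0 (Nat.zero_le _))
  have hVq : ∀ m ≤ M, P.real (V m) ≤ 2 * q := by
    intro m hm
    have hsub : V m ⊆ {ω | x < |S M ω|} ∪ {ω | x < |S m ω|} := by
      intro ω hω
      by_contra hc
      simp only [Set.mem_union, Set.mem_ofPred_eq, not_or, not_lt, hV] at hc hω
      linarith [abs_sub (S M ω) (S m ω)]
    have := (measureReal_mono hsub (measure_ne_top P _)).trans (measureReal_union_le _ _)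
    linarith [hq m hm, hq M le_rfl]
  have hdisj : ((Finset.range (M + 1) : Finset ℕ) : Set ℕ).PairwiseDisjoint E := by
    have key : ∀ i j, i < j → Disjoint (E i) (E j) := by
      intro i j hij
      refine Set.disjoint_left.2 fun ω h1 h2 => ?_
      have h3 : |S i ω| ≤ 3 * x := Set.mem_iInter₂.1 h2.2 i (Finset.mem_range.2 hij)
      have h4 : 3 * x < |S i ω| := h1.1
      linarith
    intro i _ j _ hij
    rcases lt_or_gt_of_ne hij with h | h
    · exact key i j h
    · exact (key j i h).symm
  have hsub : {ω | ∃ m ≤ M, 3 * x < |S m ω|} ⊆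
      {ω | x < |S M ω|} ∪ ⋃ m ∈ Finset.range (M + 1), (E m ∩ V m) := by
    classical
    rintro ω hω
    by_cases hM : x < |S M ω|
    · exact Or.inl hM
    right
    have hω' : ∃ m, m ≤ M ∧ 3 * x < |S m ω| := hω
    obtain ⟨h1, h2⟩ := Nat.find_spec hω'
    simp only [Set.mem_iUnion]
    refine ⟨Nat.find hω', Finset.mem_range.2 (by omega), ⟨h2, ?_⟩, ?_⟩
    · refine Set.mem_iInter₂.2 fun j hj => ?_
      have hj' := Finset.mem_range.1 hj
      have := Nat.find_min hω' hj'
      simp only [not_and, not_lt] at this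
      exact this (by omega)
    · simp only [hV, Set.mem_ofPred_eq]
      have := abs_sub_abs_le_abs_sub (S (Nat.find hω') ω) (S M ω)
      rw [abs_sub_comm] at this
      linarith [not_lt.1 hM]
  calc P.real {ω | ∃ m ≤ M, 3 * x < |S m ω|}
      ≤ P.real {ω | x < |S M ω|} + ∑ m ∈ Finset.range (M + 1), P.real (E m ∩ V m) :=
        ((measureReal_mono hsub (measure_ne_top P _)).trans (measureReal_union_le _ _)).trans
          (add_le_add le_rfl (measureReal_biUnion_finset_le _ _))
    _ ≤ q + ∑ m ∈ Finset.range (M + 1), P.real (E m) * (2 * q) := by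
        refine add_le_add (hq M le_rfl) (Finset.sum_le_sum fun m hm => ?_)
        have hm' : m ≤ M := Nat.lt_succ_iff.1 (Finset.mem_range.1 hm)
        rw [hindep m hm']
        exact mul_le_mul_of_nonneg_left (hVq m hm') measureReal_nonneg
    _ = q + P.real (⋃ m ∈ Finset.range (M + 1), E m) * (2 * q) := by
        rw [← Finset.sum_mul, measureReal_biUnion_finset hdisj fun m _ => hEm m]
    _ ≤ q + 1 * (2 * q) := by
        gcongr
        exact measureReal_le_one
    _ = 3 * q := by ring

/-! ### Tightness and the upper tail estimate -/

theorem exists_measureReal_lt_abs_le (ν : Measure ℝ) [IsProbabilityMeasure ν] {η : ℝ} (hη : 0 < η) :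
    ∃ K : ℝ, 0 < K ∧ ν.real {z | K < |z|} < η := by
  have h := tendsto_measure_norm_gt_of_isTightMeasureSet (isTightMeasureSet_singleton (μ := ν))
  simp only [Set.mem_singleton_iff, iSup_iSup_eq_left] at h
  have h1 : ∀ᶠ r : ℝ in atTop, ν {z | r < ‖z‖} < ENNReal.ofReal η :=
    h.eventually_lt_const (by simpa using hη)
  obtain ⟨K, hK, hK0⟩ := (h1.and (eventually_gt_atTop 0)).exists
  refine ⟨K, hK0, ?_⟩
  have := (ENNReal.toReal_lt_toReal (measure_ne_top _ _) ENNReal.ofReal_ne_top).2 hK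
  rwa [ENNReal.toReal_ofReal hη.le] at this

/-- The law of `n` independent variables with law `G`. -/
noncomputable abbrev powLaw (G : ProbabilityMeasure ℝ) (n : ℕ) : Measure (Fin n → ℝ) :=
  Measure.pi fun _ : Fin n => (G : Measure ℝ)

theorem coe_normedSumLaw (G : ProbabilityMeasure ℝ) (α d : ℝ) (n : ℕ) :
    (normedSumLaw G α d n : Measure ℝ) =
      (powLaw G n).map fun z => ((∑ i, z i) - d) / (n : ℝ) ^ (1 / α) := by
  rw [normedSumLaw, ProbabilityMeasure.toMeasure_map, ProbabilityMeasure.toMeasure_pi]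

/-- The normed and centered sums are tight. -/
theorem InDomainOfNormalAttraction.tight {G : ProbabilityMeasure ℝ} {α c : ℝ} {d : ℕ → ℝ}
    (hG : InDomainOfNormalAttraction G α c d) {η : ℝ} (hη : 0 < η) :
    ∃ K : ℝ, 0 < K ∧ ∀ᶠ n : ℕ in atTop,
      (powLaw G n).real {z | K * (n : ℝ) ^ (1 / α) < |(∑ i, z i) - d n|} < η := by
  obtain ⟨ν, -, hν⟩ := hG
  obtain ⟨K, hK, hKν⟩ := exists_measureReal_lt_abs_le (ν : Measure ℝ) hη
  -- The shift leaves room for a closed set between the two strict inequalities, as the portmanteau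
  -- bound needs one.
  refine ⟨K + 1, by positivity, ?_⟩
  have hF : IsClosed {z : ℝ | K + 1 ≤ |z|} := isClosed_le continuous_const continuous_abs
  have h1 := FiniteMeasure.limsup_measure_closed_le_of_tendsto
    ((ProbabilityMeasure.tendsto_nhds_iff_toFiniteMeasure_tendsto_nhds _).1 hν) hF
  have h2 : (ν : Measure ℝ) {z : ℝ | K + 1 ≤ |z|} < ENNReal.ofReal η := by
    refine lt_of_le_of_lt (measure_mono (t := {z | K < |z|}) fun z hz => ?_) ?_
    · simp only [Set.mem_ofPred_eq] at hz ⊢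
      linarith
    · exact (ENNReal.lt_ofReal_iff_toReal_lt (measure_ne_top _ _)).2 hKν
  filter_upwards [eventually_lt_of_limsup_lt (h1.trans_lt h2), eventually_gt_atTop 0] with n hn hn0
  have hpos : 0 < (n : ℝ) ^ (1 / α) := Real.rpow_pos_of_pos (by exact_mod_cast hn0) _
  have hn' : (normedSumLaw G α (d n) n : Measure ℝ) {z : ℝ | K + 1 ≤ |z|} < ENNReal.ofReal η := hn
  rw [coe_normedSumLaw, Measure.map_apply (by fun_prop) hF.measurableSet] at hn'
  have h3 := (ENNReal.lt_ofReal_iff_toReal_lt (measure_ne_top _ _)).1 hn'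
  refine lt_of_le_of_lt (measureReal_mono (fun z hz => ?_) (measure_ne_top _ _)) h3
  simp only [Set.mem_ofPred_eq, Set.mem_preimage] at hz ⊢
  rw [abs_div, abs_of_pos hpos, le_div_iff₀ hpos]
  exact hz.le

theorem powLaw_real_eval (G : ProbabilityMeasure ℝ) {n : ℕ} (i : Fin n) {s : Set ℝ}
    (hs : MeasurableSet s) :
    (powLaw G n).real {z | z i ∈ s} = (G : Measure ℝ).real s :=
  (measurePreserving_eval (fun _ : Fin n => (G : Measure ℝ)) i).measureReal_preimage
    hs.nullMeasurableSet

theorem iIndepFun_powLaw (G : ProbabilityMeasure ℝ) (n : ℕ) :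
    iIndepFun (fun (i : Fin n) z => z i) (powLaw G n) :=
  iIndepFun_pi (X := fun _ => id) fun _ => aemeasurable_id

theorem indepFun_powLaw_rest (G : ProbabilityMeasure ℝ) {n : ℕ} (i : Fin n) (d : ℝ) :
    IndepFun (fun z : Fin n → ℝ => z i) (fun z => ((∑ j, z j) - d) - z i) (powLaw G n) := by
  classical
  have h := (iIndepFun_powLaw G n).indepFun_finsetSum_of_notMem
    (fun i => measurable_pi_apply i) (Finset.notMem_erase i Finset.univ)
  have h2 := (h.symm).comp measurable_id (measurable_id.sub_const d)
  refine h2.congr (Eventually.of_forall fun z => rfl) (Eventually.of_forall fun z => ?_)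
  have := Finset.add_sum_erase Finset.univ (fun j => z j) (Finset.mem_univ i)
  simp only [Function.comp, id, Finset.sum_apply]
  linarith

/-- The tail `G (|z| > x)`. -/
noncomputable def tail (G : ProbabilityMeasure ℝ) (x : ℝ) : ℝ := (G : Measure ℝ).real {z | x < |z|}

theorem measurableSet_lt_abs (x : ℝ) : MeasurableSet {z : ℝ | x < |z|} :=
  measurableSet_lt measurable_const measurable_id.abs

theorem tail_nonneg (G : ProbabilityMeasure ℝ) (x : ℝ) : 0 ≤ tail G x := measureReal_nonneg

theorem tail_le_one (G : ProbabilityMeasure ℝ) (x : ℝ) : tail G x ≤ 1 := measureReal_le_one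

theorem tail_anti (G : ProbabilityMeasure ℝ) : Antitone (tail G) := fun _ _ h =>
  measureReal_mono (fun _ hz => lt_of_le_of_lt h hz) (measure_ne_top _ _)

theorem eventually_tail_lt (G : ProbabilityMeasure ℝ) {η : ℝ} (hη : 0 < η) :
    ∀ᶠ x in atTop, tail G x < η := by
  obtain ⟨K, -, hK⟩ := exists_measureReal_lt_abs_le (G : Measure ℝ) hη
  filter_upwards [eventually_ge_atTop K] with x hx
  exact (tail_anti G hx).trans_lt hK

theorem tendsto_natCast_rpow_atTop {r : ℝ} (hr : 0 < r) :
    Tendsto (fun n : ℕ => (n : ℝ) ^ r) atTop atTop :=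
  (tendsto_rpow_atTop hr).comp tendsto_natCast_atTop_atTop

/-- Among sizes up to `n` there is one making `N * p` comparable to `min (n * p) 1`. -/
theorem exists_le_mul_le {p : ℝ} (hp : p ≤ 1 / 16) (n : ℕ) (h : 1 / 8 < n * p) :
    ∃ N ≤ n, N * p ≤ 1 / 8 ∧ 1 / 16 ≤ N * p := by
  have hp0 : 0 < p := by
    by_contra hc
    have := mul_nonpos_of_nonneg_of_nonpos (Nat.cast_nonneg (α := ℝ) n) (not_lt.1 hc)
    linarith
  -- With N = ⌊1 / (8p)⌋ the rounding costs at most `p ≤ 1 / 16` in `N * p`.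
  have h1 : (⌊1 / (8 * p)⌋₊ : ℝ) ≤ 1 / (8 * p) := Nat.floor_le (by positivity)
  have h2 : 1 / (8 * p) < ⌊1 / (8 * p)⌋₊ + 1 := Nat.lt_floor_add_one _
  have h3 : 1 / (8 * p) * p = 1 / 8 := by field_simp
  refine ⟨⌊1 / (8 * p)⌋₊, ?_, ?_, ?_⟩
  · have : (⌊1 / (8 * p)⌋₊ : ℝ) < n := by
      refine lt_of_le_of_lt h1 ?_
      rw [div_lt_iff₀ (by positivity)]
      linarith
    exact_mod_cast this.le
  · nlinarith
  · nlinarith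

/-- If single summands passed a large multiple of n^(1/α) too often, the single-jump inequality
would make the whole sum large and contradict tightness. The centering is part of the remainder and
does no harm. -/
theorem InDomainOfNormalAttraction.eventually_tail_le {G : ProbabilityMeasure ℝ} {α c : ℝ}
    {d : ℕ → ℝ} (hα : 0 < α) (hG : InDomainOfNormalAttraction G α c d) :
    ∃ K : ℝ, 0 < K ∧ ∀ᶠ n : ℕ in atTop, tail G (K * (n : ℝ) ^ (1 / α)) ≤ 1 / n := by
  -- Any value below 1/128 works: a group of size `N` with `N * p ≥ 1 / 16` would already give
  -- probability at least 1/128.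
  obtain ⟨K, hK, h⟩ := hG.tight (η := 1 / 200) (by norm_num)
  refine ⟨4 * K, by positivity, ?_⟩
  have hT : Tendsto (fun n : ℕ => (K * (n : ℝ) ^ (1 / α))) atTop atTop :=
    (tendsto_natCast_rpow_atTop (by positivity)).const_mul_atTop hK
  filter_upwards [h, eventually_gt_atTop 0,
    (hT.const_mul_atTop (by norm_num : (0 : ℝ) < 2)).eventually
      (eventually_tail_lt G (by norm_num : (0 : ℝ) < 1 / 16))] with n hn hn0 htail
  set y := K * (n : ℝ) ^ (1 / α) with hy
  have hy0 : 0 ≤ y := by positivity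
  rw [mul_assoc, ← hy]
  have h4 : tail G (4 * y) ≤ 1 / 16 := (tail_anti G (by linarith)).trans htail.le
  have hn0' : (0 : ℝ) < n := by exact_mod_cast hn0
  have key : ∀ N ≤ n, N * tail G (4 * y) ≤ 1 / 8 → N * tail G (4 * y) / 8 ≤ 1 / 200 := by
    intro N hN hNp
    obtain ⟨A, -, hA⟩ := Finset.exists_subset_card_eq (s := (Finset.univ : Finset (Fin n)))
      (n := N) (by simpa using hN)
    have := min_le_measureReal_lt_abs (P := powLaw G n) (X := fun i z => z i)
      (D := fun z => (∑ i, z i) - d n) A (fun i _ => measurable_pi_apply i) (by fun_prop)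
      (fun i _ j _ hij => (iIndepFun_powLaw G n).indepFun hij)
      (fun i _ => indepFun_powLaw_rest G i (d n)) (y := y) (p := tail G (4 * y))
      (fun i _ => powLaw_real_eval G i (measurableSet_lt_abs _))
      (fun i _ => (powLaw_real_eval G i (measurableSet_lt_abs _)).trans_le
        (htail.le.trans (by norm_num))) (by rwa [hA])
    rw [hA] at this
    rcases min_le_iff.1 (this.trans hn.le) with h5 | h5
    · norm_num at h5
    · exact h5
  by_cases hnp : n * tail G (4 * y) ≤ 1 / 8
  · rw [le_div_iff₀ hn0']
    linarith [key n le_rfl hnp]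
  · obtain ⟨N, hN, h5, h6⟩ := exists_le_mul_le h4 n (not_le.1 hnp)
    linarith [key N hN h5]

/-- The upper tail estimate. -/
theorem InDomainOfNormalAttraction.tail_le {G : ProbabilityMeasure ℝ} {α c : ℝ} {d : ℕ → ℝ}
    (hα : 0 < α) (hG : InDomainOfNormalAttraction G α c d) :
    ∃ C : ℝ, 0 < C ∧ ∀ x, 0 < x → tail G x ≤ C * x ^ (-α) := by
  obtain ⟨K, hK, h⟩ := hG.eventually_tail_le hα
  obtain ⟨n₀, hn₀⟩ := eventually_atTop.1 h
  set x₁ : ℝ := K * (n₀ + 1 : ℝ) ^ (1 / α) with hx₁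
  have hx₁0 : 0 < x₁ := by positivity
  -- The first term makes the bound trivial for `x ≤ x₁`. The second serves larger `x`, its factor 2
  -- paying for rounding (x/K)^α down to an integer.
  refine ⟨x₁ ^ α + 2 * K ^ α, by positivity, fun x hx => ?_⟩
  rw [add_mul]
  have hxα : 0 < x ^ (-α) := Real.rpow_pos_of_pos hx _
  by_cases hxx : x ≤ x₁
  · have h1 : 1 ≤ x₁ ^ α * x ^ (-α) := by
      rw [Real.rpow_neg hx.le, ← div_eq_mul_inv, one_le_div (by positivity)]
      exact Real.rpow_le_rpow hx.le hxx hα.le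
    have := tail_le_one G x
    have : 0 ≤ 2 * K ^ α * x ^ (-α) := by positivity
    linarith
  · push Not at hxx
    set n := ⌊(x / K) ^ α⌋₊ with hn
    have hxK : 0 < x / K := by positivity
    have h1 : (n₀ + 1 : ℝ) ≤ (x / K) ^ α := by
      have h2 : (n₀ + 1 : ℝ) ^ (1 / α) ≤ x / K := by
        rw [le_div_iff₀ hK, mul_comm]
        exact hxx.le
      calc (n₀ + 1 : ℝ) = ((n₀ + 1 : ℝ) ^ (1 / α)) ^ α := by
            rw [← Real.rpow_mul (by positivity), one_div_mul_cancel hα.ne', Real.rpow_one]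
        _ ≤ _ := Real.rpow_le_rpow (by positivity) h2 hα.le
    have hnn : n₀ + 1 ≤ n := Nat.le_floor (by exact_mod_cast h1)
    have hn1 : (1 : ℝ) ≤ n := by exact_mod_cast (by omega : 1 ≤ n)
    have hle : (n : ℝ) ≤ (x / K) ^ α := Nat.floor_le (by positivity)
    have hlt : (x / K) ^ α < n + 1 := Nat.lt_floor_add_one _
    have h3 : K * (n : ℝ) ^ (1 / α) ≤ x := by
      rw [← le_div_iff₀' hK]
      calc (n : ℝ) ^ (1 / α) ≤ ((x / K) ^ α) ^ (1 / α) :=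
            Real.rpow_le_rpow (by positivity) hle (by positivity)
        _ = x / K := by
            rw [← Real.rpow_mul hxK.le, mul_one_div_cancel hα.ne', Real.rpow_one]
    have h4 : tail G x ≤ 1 / n := (tail_anti G h3).trans (hn₀ n (by omega))
    have h5 : (1 : ℝ) / n ≤ 2 * K ^ α * x ^ (-α) := by
      rw [Real.div_rpow hx.le hK.le] at hlt
      rw [Real.rpow_neg hx.le, ← div_eq_mul_inv, div_le_div_iff₀ (by linarith) (by positivity)]
      rw [div_lt_iff₀ (by positivity)] at hlt
      have : 0 < K ^ α := by positivity
      nlinarith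
    have : 0 ≤ x₁ ^ α * x ^ (-α) := by positivity
    linarith

/-! ### Moments of truncated variables -/

/-- Truncation at level `x`. -/
noncomputable def trunc (x : ℝ) : ℝ → ℝ := Set.indicator {z | |z| ≤ x} id

theorem measurable_trunc (x : ℝ) : Measurable (trunc x) :=
  measurable_id.indicator (measurableSet_le measurable_id.abs measurable_const)

theorem measurable_sub_trunc (x : ℝ) : Measurable fun z => z - trunc x z :=
  measurable_id.sub (measurable_trunc x)

theorem trunc_of_le {x z : ℝ} (h : |z| ≤ x) : trunc x z = z :=
  Set.indicator_of_mem (s := {z | |z| ≤ x}) h id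

theorem trunc_of_lt {x z : ℝ} (h : x < |z|) : trunc x z = 0 :=
  Set.indicator_of_notMem (s := {z : ℝ | |z| ≤ x}) (not_le.2 h) id

theorem abs_trunc_le (x z : ℝ) : |trunc x z| ≤ |z| := by
  rcases le_or_gt |z| x with h | h
  · rw [trunc_of_le h]
  · simp [trunc_of_lt h]

theorem abs_trunc_le_bound {x : ℝ} (hx : 0 ≤ x) (z : ℝ) : |trunc x z| ≤ x := by
  rcases le_or_gt |z| x with h | h
  · rwa [trunc_of_le h]
  · simpa [trunc_of_lt h]

theorem measure_lt_abs_trunc_le (G : ProbabilityMeasure ℝ) (x t : ℝ) :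
    (G : Measure ℝ) {z | t < |trunc x z|} ≤ ENNReal.ofReal (tail G t) := by
  rw [tail, ofReal_measureReal]
  exact measure_mono fun z hz => lt_of_lt_of_le hz (abs_trunc_le x z)

theorem measure_lt_abs_trunc_eq_zero (G : ProbabilityMeasure ℝ) {x t : ℝ} (hx : 0 ≤ x)
    (ht : x ≤ t) : (G : Measure ℝ) {z | t < |trunc x z|} = 0 := by
  have : {z | t < |trunc x z|} = ∅ :=
    Set.eq_empty_of_forall_notMem fun z (hz : t < _) =>
      absurd (hz.trans_le (abs_trunc_le_bound hx z)) (not_lt.2 ht)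
  rw [this, measure_empty]

theorem lintegral_Ioc_const_mul_rpow {C x r : ℝ} (hC : 0 ≤ C) (hx : 0 ≤ x) (hr : -1 < r) :
    ∫⁻ t in Set.Ioc 0 x, ENNReal.ofReal (C * t ^ r) =
      ENNReal.ofReal (C * (x ^ (r + 1) / (r + 1))) := by
  rw [← ofReal_integral_eq_lintegral_ofReal]
  · rw [← intervalIntegral.integral_of_le hx, intervalIntegral.integral_const_mul,
      integral_rpow (Or.inl hr), Real.zero_rpow (by linarith), sub_zero]
  · rw [← IntegrableOn, ← intervalIntegrable_iff_integrableOn_Ioc_of_le hx]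
    exact (intervalIntegral.intervalIntegrable_rpow' hr).const_mul C
  · filter_upwards [ae_restrict_mem measurableSet_Ioc] with t ht
    have := ht.1.le
    positivity

/-- Truncated moments of order `p > α`. -/
theorem lintegral_abs_trunc_rpow_le {G : ProbabilityMeasure ℝ} {α C : ℝ} (hC : 0 ≤ C)
    (htail : ∀ x, 0 < x → tail G x ≤ C * x ^ (-α)) {p : ℝ} (hp : 0 < p) (hpα : α < p) {x : ℝ}
    (hx : 0 ≤ x) :
    ∫⁻ z, ENNReal.ofReal (|trunc x z| ^ p) ∂(G : Measure ℝ) ≤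
      ENNReal.ofReal (p * (C * (x ^ (p - α) / (p - α)))) := by
  rw [lintegral_rpow_eq_lintegral_meas_lt_mul (f := fun z => |trunc x z|) _
    (Eventually.of_forall fun z => abs_nonneg _) (measurable_trunc x).abs.aemeasurable hp,
    ENNReal.ofReal_mul hp.le]
  gcongr
  calc _ ≤ ∫⁻ t in Set.Ioi 0, (Set.Ioc 0 x).indicator
            (fun t => ENNReal.ofReal (C * t ^ (p - α - 1))) t := by
        refine setLIntegral_mono' measurableSet_Ioi fun t (ht : 0 < t) => ?_
        rcases le_or_gt t x with h | h
        · rw [Set.indicator_of_mem (by exact ⟨ht, h⟩)]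
          refine (mul_le_mul_left ((measure_lt_abs_trunc_le G x t).trans
            (ENNReal.ofReal_le_ofReal (htail t ht))) _).trans ?_
          rw [← ENNReal.ofReal_mul (by positivity), mul_assoc, ← Real.rpow_add ht]
          refine le_of_eq ?_
          ring_nf
        · rw [measure_lt_abs_trunc_eq_zero G hx h.le, zero_mul]
          exact zero_le
    _ = ∫⁻ t in Set.Ioc 0 x, ENNReal.ofReal (C * t ^ (p - α - 1)) := by
        rw [lintegral_indicator measurableSet_Ioc, Measure.restrict_restrict measurableSet_Ioc,
          Set.inter_eq_self_of_subset_left fun t ht => ht.1]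
    _ = _ := by
        rw [lintegral_Ioc_const_mul_rpow hC hx (by linarith)]
        simp

theorem integral_le_of_lintegral_le {μ : Measure ℝ} {g : ℝ → ℝ} (hg : Measurable g)
    (hg0 : ∀ z, 0 ≤ g z) {r : ℝ} (hr : 0 ≤ r) (h : ∫⁻ z, ENNReal.ofReal (g z) ∂μ ≤ ENNReal.ofReal r) :
    ∫ z, g z ∂μ ≤ r := by
  rw [integral_eq_lintegral_of_nonneg_ae (Eventually.of_forall hg0) hg.aestronglyMeasurable]
  exact ENNReal.toReal_le_of_le_ofReal hr h

theorem exists_integral_trunc_sq_le {G : ProbabilityMeasure ℝ} {α : ℝ} (hα2 : α < 2)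
    (htail : ∃ C : ℝ, 0 < C ∧ ∀ x, 0 < x → tail G x ≤ C * x ^ (-α)) :
    ∃ C : ℝ, 0 < C ∧ ∀ x, 0 ≤ x → ∫ z, trunc x z ^ 2 ∂(G : Measure ℝ) ≤ C * x ^ (2 - α) := by
  obtain ⟨C, hC, htail⟩ := htail
  have h2 : 0 < 2 - α := by linarith
  refine ⟨2 * C / (2 - α), by positivity, fun x hx => ?_⟩
  have := lintegral_abs_trunc_rpow_le hC.le htail (p := 2) two_pos hα2 hx
  have h3 : 2 * C / (2 - α) * x ^ (2 - α) = 2 * (C * (x ^ (2 - α) / (2 - α))) := by ring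
  rw [h3]
  refine integral_le_of_lintegral_le ((measurable_trunc x).pow_const 2) (fun z => sq_nonneg _)
    (by positivity) ?_
  simpa [Real.rpow_ofNat] using this

theorem abs_integral_trunc_le_of_lt_one {G : ProbabilityMeasure ℝ} {α : ℝ} (hα : α < 1)
    (htail : ∃ C : ℝ, 0 < C ∧ ∀ x, 0 < x → tail G x ≤ C * x ^ (-α)) :
    ∃ C : ℝ, 0 < C ∧ ∀ x, 0 < x → |∫ z, trunc x z ∂(G : Measure ℝ)| ≤ C * x ^ (1 - α) := by
  obtain ⟨C, hC, htail⟩ := htail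
  have h2 : 0 < 1 - α := by linarith
  refine ⟨C / (1 - α), by positivity, fun x hx => ?_⟩
  have := lintegral_abs_trunc_rpow_le hC.le htail (p := 1) one_pos hα hx.le
  have h3 : C / (1 - α) * x ^ (1 - α) = 1 * (C * (x ^ (1 - α) / (1 - α))) := by ring
  rw [h3]
  refine abs_integral_le_integral_abs.trans ?_
  refine integral_le_of_lintegral_le (measurable_trunc x).abs (fun z => abs_nonneg _)
    (by positivity) ?_
  simpa using this

/-- In the critical case the layer-cake integral of the tail `C / t` over (1, x] is logarithmic.
This is the source of the side condition for exponent 1. -/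
theorem abs_integral_trunc_le_of_eq_one {G : ProbabilityMeasure ℝ}
    (htail : ∃ C : ℝ, 0 < C ∧ ∀ x, 0 < x → tail G x ≤ C * x ^ (-1 : ℝ)) :
    ∃ C : ℝ, 0 < C ∧ ∀ x, 1 ≤ x → |∫ z, trunc x z ∂(G : Measure ℝ)| ≤ C * (1 + Real.log x) := by
  obtain ⟨C, hC, htail⟩ := htail
  refine ⟨1 + C, by positivity, fun x hx => ?_⟩
  have hlog : 0 ≤ Real.log x := Real.log_nonneg hx
  refine abs_integral_le_integral_abs.trans (le_trans (b := 1 + C * Real.log x) ?_ (by nlinarith))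
  refine integral_le_of_lintegral_le (measurable_trunc x).abs (fun z => abs_nonneg _)
    (by positivity) ?_
  rw [lintegral_eq_lintegral_meas_lt _ (Eventually.of_forall fun z => abs_nonneg _)
    (measurable_trunc x).abs.aemeasurable]
  have hx0 : 0 ≤ x := by linarith
  have hU : Set.Ioi (0 : ℝ) = (Set.Ioc 0 1 ∪ Set.Ioc 1 x) ∪ Set.Ioi x := by
    rw [Set.Ioc_union_Ioc_eq_Ioc zero_le_one hx, Set.Ioc_union_Ioi_eq_Ioi hx0]
  have h1 : ∫⁻ t in Set.Ioc (0 : ℝ) 1, (G : Measure ℝ) {z | t < |trunc x z|} ≤ ENNReal.ofReal 1 := by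
    refine (lintegral_mono fun t => prob_le_one).trans ?_
    simp
  have h2 : ∫⁻ t in Set.Ioc (1 : ℝ) x, (G : Measure ℝ) {z | t < |trunc x z|} ≤
      ENNReal.ofReal (C * Real.log x) := by
    have : ∫⁻ t in Set.Ioc (1 : ℝ) x, ENNReal.ofReal (C * t⁻¹) = ENNReal.ofReal (C * Real.log x) := by
      rw [← ofReal_integral_eq_lintegral_ofReal]
      · rw [← intervalIntegral.integral_of_le hx, intervalIntegral.integral_const_mul,
          integral_inv_of_pos one_pos (by linarith), div_one]
      · rw [← IntegrableOn, ← intervalIntegrable_iff_integrableOn_Ioc_of_le hx]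
        refine (intervalIntegral.intervalIntegrable_inv (fun t ht => ?_) continuousOn_id).const_mul C
        rw [Set.uIcc_of_le hx] at ht
        have := ht.1
        simp only [id]
        linarith
      · filter_upwards [ae_restrict_mem measurableSet_Ioc] with t ht
        have : 0 < t := zero_lt_one.trans ht.1
        positivity
    rw [← this]
    refine setLIntegral_mono' measurableSet_Ioc fun t ht => ?_
    refine (measure_lt_abs_trunc_le G x t).trans (ENNReal.ofReal_le_ofReal ?_)
    have := htail t (zero_lt_one.trans ht.1)
    rwa [Real.rpow_neg_one] at this
  have h3 : ∫⁻ t in Set.Ioi x, (G : Measure ℝ) {z | t < |trunc x z|} = 0 := by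
    rw [setLIntegral_congr_fun (g := fun _ => 0) measurableSet_Ioi fun t (ht : x < t) =>
      measure_lt_abs_trunc_eq_zero G hx0 ht.le]
    simp
  rw [hU, ENNReal.ofReal_add zero_le_one (by positivity)]
  refine (lintegral_union_le _ _ _).trans ?_
  rw [h3, add_zero]
  exact (lintegral_union_le _ _ _).trans (add_le_add h1 h2)

theorem lintegral_Ioi_const_mul_rpow {C x r : ℝ} (hC : 0 ≤ C) (hx : 0 < x) (hr : r < -1) :
    ∫⁻ t in Set.Ioi x, ENNReal.ofReal (C * t ^ r) =
      ENNReal.ofReal (C * (-x ^ (r + 1) / (r + 1))) := by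
  rw [← ofReal_integral_eq_lintegral_ofReal]
  · rw [integral_const_mul, integral_Ioi_rpow_of_lt hr hx]
  · exact (integrableOn_Ioi_rpow_of_lt hr hx).const_mul C
  · filter_upwards [ae_restrict_mem measurableSet_Ioi] with t ht
    have : 0 < t := hx.trans ht
    positivity

/-- The part of the first absolute moment beyond `x`, for `α > 1`. -/
theorem lintegral_abs_sub_trunc_le {G : ProbabilityMeasure ℝ} {α C : ℝ} (hα : 1 < α) (hC : 0 ≤ C)
    (htail : ∀ x, 0 < x → tail G x ≤ C * x ^ (-α)) {x : ℝ} (hx : 0 < x) :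
    ∫⁻ z, ENNReal.ofReal |z - trunc x z| ∂(G : Measure ℝ) ≤
      ENNReal.ofReal ((C + C / (α - 1)) * x ^ (1 - α)) := by
  have hα' : 0 < α - 1 := by linarith
  rw [lintegral_eq_lintegral_meas_lt _ (Eventually.of_forall fun z => abs_nonneg _)
    (measurable_sub_trunc x).abs.aemeasurable]
  have hsub : ∀ t, 0 < t → {z | t < |z - trunc x z|} ⊆ {z | max x t < |z|} := by
    intro t ht z (hz : t < _)
    rcases le_or_gt |z| x with h | h
    · rw [trunc_of_le h, sub_self, abs_zero] at hz
      linarith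
    · rw [trunc_of_lt h, sub_zero] at hz
      exact max_lt h hz
  have hle : ∀ t, 0 < t → (G : Measure ℝ) {z | t < |z - trunc x z|} ≤
      ENNReal.ofReal (C * (max x t) ^ (-α)) := by
    intro t ht
    refine (measure_mono (hsub t ht)).trans ?_
    rw [← ofReal_measureReal]
    exact ENNReal.ofReal_le_ofReal (htail _ (lt_max_of_lt_left hx))
  have h1 : ∫⁻ t in Set.Ioc (0 : ℝ) x, (G : Measure ℝ) {z | t < |z - trunc x z|} ≤
      ENNReal.ofReal (C * x ^ (1 - α)) := by
    calc _ ≤ ∫⁻ t in Set.Ioc (0 : ℝ) x, ENNReal.ofReal (C * x ^ (-α)) := by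
          refine setLIntegral_mono' measurableSet_Ioc fun t ht => ?_
          simpa [max_eq_left ht.2] using hle t ht.1
      _ = _ := by
          rw [lintegral_const, Measure.restrict_apply_univ, Real.volume_Ioc, sub_zero,
            ← ENNReal.ofReal_mul (by positivity), mul_assoc, ← Real.rpow_add_one hx.ne']
          ring_nf
  have h2 : ∫⁻ t in Set.Ioi x, (G : Measure ℝ) {z | t < |z - trunc x z|} ≤
      ENNReal.ofReal (C / (α - 1) * x ^ (1 - α)) := by
    calc _ ≤ ∫⁻ t in Set.Ioi x, ENNReal.ofReal (C * t ^ (-α)) := by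
          refine setLIntegral_mono' measurableSet_Ioi fun t (ht : x < t) => ?_
          simpa [max_eq_right ht.le] using hle t (hx.trans ht)
      _ = _ := by
          rw [lintegral_Ioi_const_mul_rpow hC hx (by linarith)]
          congr 1
          have : -α + 1 = -(α - 1) := by ring
          rw [this, neg_div_neg_eq]
          ring_nf
  rw [← Set.Ioc_union_Ioi_eq_Ioi hx.le, add_mul, ENNReal.ofReal_add (by positivity) (by positivity)]
  exact (lintegral_union_le _ _ _).trans (add_le_add h1 h2)

theorem integrable_trunc (G : ProbabilityMeasure ℝ) {x : ℝ} (hx : 0 ≤ x) :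
    Integrable (trunc x) (G : Measure ℝ) :=
  Integrable.of_bound (measurable_trunc x).aestronglyMeasurable x
    (Eventually.of_forall fun z => abs_trunc_le_bound hx z)

theorem integrable_id_of_tail_le {G : ProbabilityMeasure ℝ} {α : ℝ} (hα : 1 < α)
    (htail : ∃ C : ℝ, 0 < C ∧ ∀ x, 0 < x → tail G x ≤ C * x ^ (-α)) :
    Integrable (fun z : ℝ => z) (G : Measure ℝ) := by
  obtain ⟨C, hC, htail⟩ := htail
  have h : Integrable (fun z => z - trunc 1 z) (G : Measure ℝ) := by
    refine ⟨(measurable_sub_trunc 1).aestronglyMeasurable, ?_⟩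
    rw [hasFiniteIntegral_iff_norm]
    exact (lintegral_abs_sub_trunc_le hα hC.le htail one_pos).trans_lt ENNReal.ofReal_lt_top
  exact (h.add (integrable_trunc G zero_le_one)).congr (Eventually.of_forall fun z => by simp)

/-- As the mean vanishes, the truncated mean is minus the mean of the discarded part, which the tail
controls. -/
theorem abs_integral_trunc_le_of_one_lt {G : ProbabilityMeasure ℝ} {α : ℝ} (hα : 1 < α)
    (htail : ∃ C : ℝ, 0 < C ∧ ∀ x, 0 < x → tail G x ≤ C * x ^ (-α))
    (hmean : ∫ z, z ∂(G : Measure ℝ) = 0) :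
    ∃ C : ℝ, 0 < C ∧ ∀ x, 0 < x → |∫ z, trunc x z ∂(G : Measure ℝ)| ≤ C * x ^ (1 - α) := by
  have hint := integrable_id_of_tail_le hα htail
  obtain ⟨C, hC, htail⟩ := htail
  have hα' : 0 < α - 1 := by linarith
  refine ⟨C + C / (α - 1), by positivity, fun x hx => ?_⟩
  have h1 : ∫ z, (z - trunc x z) ∂(G : Measure ℝ) = -∫ z, trunc x z ∂(G : Measure ℝ) := by
    rw [integral_sub hint (integrable_trunc G hx.le), hmean, zero_sub]
  rw [← abs_neg, ← h1]
  refine abs_integral_le_integral_abs.trans ?_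
  exact integral_le_of_lintegral_le (measurable_sub_trunc x).abs
    (fun z => abs_nonneg _) (by positivity) (lintegral_abs_sub_trunc_le hα hC.le htail hx)

/-! ### Upper bounds for sums by truncation -/

/-- Truncation bound for the sum of pairwise independent variables with law `G`. -/
theorem measureReal_lt_abs_sum_le {ι Ω : Type*} [MeasurableSpace Ω] {P : Measure Ω}
    [IsProbabilityMeasure P] {X : ι → Ω → ℝ} {G : ProbabilityMeasure ℝ} (A : Finset ι)
    (hX : ∀ i ∈ A, Measurable (X i))
    (hpair : ∀ i ∈ A, ∀ j ∈ A, i ≠ j → IndepFun (X i) (X j) P)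
    (hlaw : ∀ i ∈ A, P.map (X i) = (G : Measure ℝ)) {x : ℝ} (hx : 0 < x)
    (hmean : A.card * |∫ z, trunc x z ∂(G : Measure ℝ)| ≤ x / 2) :
    P.real {ω | x < |∑ i ∈ A, X i ω|} ≤
      A.card * tail G x + 4 * A.card * (∫ z, trunc x z ^ 2 ∂(G : Measure ℝ)) / x ^ 2 := by
  set Y : ι → Ω → ℝ := fun i ω => trunc x (X i ω) with hY
  have hYm : ∀ i ∈ A, Measurable (Y i) := fun i hi => (measurable_trunc x).comp (hX i hi)
  have hYL : ∀ i ∈ A, MemLp (Y i) 2 P := fun i hi =>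
    MemLp.of_bound (hYm i hi).aestronglyMeasurable x
      (Eventually.of_forall fun ω => abs_trunc_le_bound hx.le _)
  have hEY : ∀ i ∈ A, ∫ ω, Y i ω ∂P = ∫ z, trunc x z ∂(G : Measure ℝ) := by
    intro i hi
    rw [← hlaw i hi, integral_map (hX i hi).aemeasurable (measurable_trunc x).aestronglyMeasurable]
  have hEY2 : ∀ i ∈ A, ∫ ω, Y i ω ^ 2 ∂P = ∫ z, trunc x z ^ 2 ∂(G : Measure ℝ) := by
    intro i hi
    rw [← hlaw i hi, integral_map (hX i hi).aemeasurable
      ((measurable_trunc x).pow_const 2).aestronglyMeasurable]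
  set W : Ω → ℝ := ∑ i ∈ A, Y i with hW
  have hWL : MemLp W 2 P := memLp_finsetSum' A hYL
  have hEW : ∫ ω, W ω ∂P = A.card * ∫ z, trunc x z ∂(G : Measure ℝ) := by
    simp only [hW, Finset.sum_apply]
    rw [integral_finsetSum A fun i hi => (hYL i hi).integrable one_le_two, Finset.sum_congr rfl hEY]
    simp
  have hVar : Var[W; P] ≤ A.card * ∫ z, trunc x z ^ 2 ∂(G : Measure ℝ) := by
    rw [hW, IndepFun.variance_sum hYL]
    · calc _ ≤ ∑ i ∈ A, ∫ z, trunc x z ^ 2 ∂(G : Measure ℝ) := by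
            refine Finset.sum_le_sum fun i hi => ?_
            rw [← hEY2 i hi]
            exact variance_le_expectation_sq (hYm i hi).aestronglyMeasurable
        _ = _ := by simp
    · intro i hi j hj hij
      exact (hpair i hi j hj hij).comp (measurable_trunc x) (measurable_trunc x)
  -- Half of the level `x` is reserved for the mean of the truncated sum, so Chebyshev is applied at
  -- `x / 2`.
  have hcheb : P.real {ω | x / 2 ≤ |W ω - ∫ ω, W ω ∂P|} ≤
      4 * A.card * (∫ z, trunc x z ^ 2 ∂(G : Measure ℝ)) / x ^ 2 := by
    have h := meas_ge_le_variance_div_sq hWL (c := x / 2) (by positivity)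
    have h2 := ENNReal.toReal_le_of_le_ofReal (div_nonneg (variance_nonneg _ _) (sq_nonneg _)) h
    refine h2.trans ?_
    have : 4 * A.card * (∫ z, trunc x z ^ 2 ∂(G : Measure ℝ)) / x ^ 2 =
      (A.card * ∫ z, trunc x z ^ 2 ∂(G : Measure ℝ)) / (x / 2) ^ 2 := by
      field_simp
      ring
    rw [this]
    gcongr
  have hsub : {ω | x < |∑ i ∈ A, X i ω|} ⊆
      (⋃ i ∈ A, {ω | x < |X i ω|}) ∪ {ω | x / 2 ≤ |W ω - ∫ ω, W ω ∂P|} := by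
    intro ω hω
    by_cases h : ω ∈ ⋃ i ∈ A, {ω | x < |X i ω|}
    · exact Or.inl h
    right
    have h' : ∀ i ∈ A, |X i ω| ≤ x := by
      intro i hi
      by_contra hc
      exact h (Set.mem_iUnion₂.2 ⟨i, hi, not_le.1 hc⟩)
    have hWX : W ω = ∑ i ∈ A, X i ω := by
      simp only [hW, Finset.sum_apply]
      exact Finset.sum_congr rfl fun i hi => trunc_of_le (h' i hi)
    simp only [Set.mem_ofPred_eq] at hω ⊢
    rw [hEW, hWX]
    have h1 := abs_sub_abs_le_abs_sub (∑ i ∈ A, X i ω) (A.card * ∫ z, trunc x z ∂(G : Measure ℝ))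
    rw [abs_mul, Nat.abs_cast] at h1
    linarith
  refine ((measureReal_mono hsub (measure_ne_top P _)).trans (measureReal_union_le _ _)).trans
    (add_le_add ?_ hcheb)
  refine (measureReal_biUnion_finset_le _ _).trans ?_
  calc ∑ i ∈ A, P.real {ω | x < |X i ω|} = ∑ i ∈ A, tail G x := by
        refine Finset.sum_congr rfl fun i hi => ?_
        rw [tail, ← hlaw i hi, map_measureReal_apply (hX i hi) (measurableSet_lt_abs x)]
        rfl
    _ ≤ _ := by simp

/-- Numerical form of the statement that sums of `N` independent variables with law `G` exceed `x`
with probability at most `C * N * x ^ (-α)`. -/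
def SumBound (G : ProbabilityMeasure ℝ) (α C κ : ℝ) : Prop :=
  ∀ (N : ℕ) (x : ℝ), 0 < x → (α = 1 → N * (1 + Real.log N) ≤ κ * x) →
    1 ≤ C * N * x ^ (-α) ∨
      (N * |∫ z, trunc x z ∂(G : Measure ℝ)| ≤ x / 2 ∧
        N * tail G x + 4 * N * (∫ z, trunc x z ^ 2 ∂(G : Measure ℝ)) / x ^ 2 ≤ C * N * x ^ (-α))

theorem SumBound.measureReal_le {ι Ω : Type*} [MeasurableSpace Ω] {P : Measure Ω}
    [IsProbabilityMeasure P] {X : ι → Ω → ℝ} {G : ProbabilityMeasure ℝ} {α C κ : ℝ}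
    (hG : SumBound G α C κ) (A : Finset ι) (hX : ∀ i ∈ A, Measurable (X i))
    (hpair : ∀ i ∈ A, ∀ j ∈ A, i ≠ j → IndepFun (X i) (X j) P)
    (hlaw : ∀ i ∈ A, P.map (X i) = (G : Measure ℝ)) {x : ℝ} (hx : 0 < x)
    (hA : α = 1 → A.card * (1 + Real.log A.card) ≤ κ * x) :
    P.real {ω | x < |∑ i ∈ A, X i ω|} ≤ C * A.card * x ^ (-α) := by
  rcases hG A.card x hx hA with h | ⟨h1, h2⟩
  · exact measureReal_le_one.trans h
  · exact (measureReal_lt_abs_sum_le A hX hpair hlaw hx h1).trans h2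

/-- Turns the side condition, which involves log N, into the bound on the truncated mean, which
involves log x. With `l = x / N` one has log x = log N + log l, and both terms are small multiples
of `l`. -/
theorem exists_mul_one_add_log_le {D : ℝ} (hD : 0 < D) :
    ∃ κ : ℝ, 0 < κ ∧ ∀ (N : ℕ) (x : ℝ), 1 ≤ N → N * (1 + Real.log N) ≤ κ * x →
      1 ≤ x ∧ N * (D * (1 + Real.log x)) ≤ x / 2 := by
  set δ : ℝ := min 1 (1 / (6 * D)) with hδ
  have hδ0 : 0 < δ := by positivity
  have hδ1 : δ ≤ 1 := min_le_left _ _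
  have hδD : 6 * D * δ ≤ 1 := by
    have := min_le_right 1 (1 / (6 * D))
    rw [← hδ, le_div_iff₀ (by positivity)] at this
    linarith
  refine ⟨δ ^ 2, by positivity, fun N x hN h => ?_⟩
  have hN1 : (1 : ℝ) ≤ N := by exact_mod_cast hN
  have hN0 : (0 : ℝ) < N := by linarith
  have hlogN : 0 ≤ Real.log N := Real.log_nonneg hN1
  have hNx : (N : ℝ) ≤ δ ^ 2 * x := by nlinarith
  have hx0 : 0 < x := by
    by_contra hc
    nlinarith [sq_nonneg δ]
  have hδ2 : δ ^ 2 ≤ 1 := by nlinarith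
  have hx1 : 1 ≤ x := by nlinarith
  refine ⟨hx1, ?_⟩
  set l := x / N with hl
  have hxl : x = N * l := by rw [hl]; field_simp
  have hl0 : 0 < l := by positivity
  have hl1 : 1 ≤ δ ^ 2 * l := by
    rw [hxl] at hNx
    nlinarith
  have hlogNl : 1 + Real.log N ≤ δ ^ 2 * l := by
    rw [hxl] at h
    nlinarith
  have hlogx : Real.log x = Real.log N + Real.log l := by
    rw [hxl, Real.log_mul hN0.ne' hl0.ne']
  have hsq : 0 < Real.sqrt l := Real.sqrt_pos.2 hl0
  -- Passing to √l makes log l at most a multiple `δ` of `l`, because `δ ^ 2 * l ≥ 1`.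
  have hlogl : Real.log l ≤ 2 * (Real.sqrt l - 1) := by
    have h1 := Real.log_le_sub_one_of_pos hsq
    have h2 : Real.log l = 2 * Real.log (Real.sqrt l) := by
      rw [Real.log_sqrt hl0.le]
      ring
    linarith
  have hsl : Real.sqrt l ≤ δ * l := by
    have h1 : Real.sqrt l * Real.sqrt l = l := Real.mul_self_sqrt hl0.le
    have h2 : 1 ≤ δ * Real.sqrt l := by
      by_contra hc
      push Not at hc
      have : (δ * Real.sqrt l) * (δ * Real.sqrt l) < 1 := by nlinarith [mul_pos hδ0 hsq]
      nlinarith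
    nlinarith
  have hsum : 1 + Real.log x ≤ 3 * δ * l := by
    have : δ ^ 2 * l ≤ δ * l := by nlinarith [mul_pos hδ0 hl0]
    linarith
  calc N * (D * (1 + Real.log x)) ≤ N * (D * (3 * δ * l)) := by gcongr
    _ = (6 * D * δ) * (N * l) / 2 := by ring
    _ ≤ 1 * (N * l) / 2 := by gcongr
    _ = x / 2 := by rw [← hxl, one_mul]

/-- The tail term and the truncated second moment both have order N x^(-α). For α ≠ 1 the truncated
mean is O(x^(1-α)), so N times it is at most x / 2 unless N x^(-α) is bounded below, when the bound
is trivial. For α = 1 the side condition takes the place of this dichotomy. -/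
theorem exists_sumBound {G : ProbabilityMeasure ℝ} {α : ℝ} (hα2 : α < 2)
    (htail : ∃ C : ℝ, 0 < C ∧ ∀ x, 0 < x → tail G x ≤ C * x ^ (-α))
    (hmean : 1 < α → ∫ z, z ∂(G : Measure ℝ) = 0) :
    ∃ C κ : ℝ, 0 < C ∧ 0 < κ ∧ SumBound G α C κ := by
  obtain ⟨C₂, hC₂, h2⟩ := exists_integral_trunc_sq_le hα2 htail
  have htail' := htail
  obtain ⟨C₁, hC₁, h1⟩ := htail
  have hmain : ∀ (N : ℕ) (x : ℝ), 0 < x →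
      N * tail G x + 4 * N * (∫ z, trunc x z ^ 2 ∂(G : Measure ℝ)) / x ^ 2 ≤
        (C₁ + 4 * C₂) * N * x ^ (-α) := by
    intro N x hx
    have h3 : x ^ (2 - α) = x ^ (-α) * x ^ 2 := by
      rw [sub_eq_neg_add, Real.rpow_add hx, Real.rpow_two]
    have h4 : N * tail G x ≤ N * (C₁ * x ^ (-α)) := by gcongr; exact h1 x hx
    have h5 : 4 * N * (∫ z, trunc x z ^ 2 ∂(G : Measure ℝ)) / x ^ 2 ≤
        4 * N * (C₂ * x ^ (-α)) := by
      rw [div_le_iff₀ (by positivity)]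
      calc 4 * N * (∫ z, trunc x z ^ 2 ∂(G : Measure ℝ)) ≤ 4 * N * (C₂ * x ^ (2 - α)) := by
            gcongr; exact h2 x hx.le
        _ = _ := by rw [h3]; ring
    linarith
  by_cases hα1 : α = 1
  · subst hα1
    obtain ⟨D, hD, h3⟩ := abs_integral_trunc_le_of_eq_one htail'
    obtain ⟨κ, hκ, h4⟩ := exists_mul_one_add_log_le hD
    refine ⟨C₁ + 4 * C₂, κ, by positivity, hκ, fun N x hx hN => Or.inr ⟨?_, hmain N x hx⟩⟩
    rcases Nat.eq_zero_or_pos N with rfl | hN0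
    · simp only [CharP.cast_eq_zero, zero_mul]
      positivity
    · obtain ⟨h5, h6⟩ := h4 N x hN0 (hN rfl)
      refine le_trans ?_ h6
      gcongr
      exact h3 x h5
  · obtain ⟨D, hD, h3⟩ : ∃ D : ℝ, 0 < D ∧ ∀ x, 0 < x →
        |∫ z, trunc x z ∂(G : Measure ℝ)| ≤ D * x ^ (1 - α) := by
      rcases lt_or_gt_of_ne hα1 with h | h
      · exact abs_integral_trunc_le_of_lt_one h htail'
      · exact abs_integral_trunc_le_of_one_lt h htail' (hmean h)
    refine ⟨C₁ + 4 * C₂ + 2 * D, 1, by positivity, one_pos, fun N x hx _ => ?_⟩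
    have hN0 : 0 ≤ N * x ^ (-α) := by positivity
    by_cases h4 : N * |∫ z, trunc x z ∂(G : Measure ℝ)| ≤ x / 2
    · refine Or.inr ⟨h4, (hmain N x hx).trans ?_⟩
      rw [mul_assoc, mul_assoc]
      exact mul_le_mul_of_nonneg_right (by linarith) hN0
    · left
      push Not at h4
      have h5 : x / 2 < N * (D * x ^ (1 - α)) := h4.trans_le (by gcongr; exact h3 x hx)
      have h6 : x ^ (1 - α) = x ^ (-α) * x := by
        rw [sub_eq_neg_add, Real.rpow_add_one hx.ne']
      rw [h6] at h5
      have h7 : 1 * (x / 2) < (2 * D * N * x ^ (-α)) * (x / 2) := by linarith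
      have h8 := lt_of_mul_lt_mul_right h7 (by positivity)
      nlinarith

/-! ### Vanishing mean for exponents above 1 -/

/-- For `α > 1`, sums without centering force mean zero. -/
theorem InDomainOfNormalAttraction.integral_eq_zero {G : ProbabilityMeasure ℝ} {α c : ℝ}
    {d : ℕ → ℝ} (hα1 : 1 < α) (hα2 : α < 2) (hG : InDomainOfNormalAttraction G α c d)
    (hd : ∀ n, d n = 0) : ∫ z, z ∂(G : Measure ℝ) = 0 := by
  have hα : 0 < α := by linarith
  have htail := hG.tail_le hα
  have hint := integrable_id_of_tail_le hα1 htail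
  set m := ∫ z, z ∂(G : Measure ℝ) with hm
  have hsubm : Measurable fun z : ℝ => z - m := measurable_id.sub_const m
  -- The centered law satisfies the sum bound, so its sums are O(n^(1/α)) with probability at least
  -- 1/2. Tightness gives the same for the uncentered sums, and the difference `n * m` can be that
  -- small only if `m = 0`.
  let G' : ProbabilityMeasure ℝ := G.map (f := fun z => z - m) hsubm.aemeasurable
  have hG' : (G' : Measure ℝ) = (G : Measure ℝ).map fun z => z - m :=
    ProbabilityMeasure.toMeasure_map ..
  have htail' : ∃ C : ℝ, 0 < C ∧ ∀ x, 0 < x → tail G' x ≤ C * x ^ (-α) := by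
    obtain ⟨C, hC, h⟩ := htail
    refine ⟨C * 2 ^ α + (2 * |m|) ^ α, by positivity, fun x hx => ?_⟩
    have hxα : 0 < x ^ (-α) := Real.rpow_pos_of_pos hx _
    rw [add_mul]
    by_cases hxm : x ≤ 2 * |m|
    · have h1 : 1 ≤ (2 * |m|) ^ α * x ^ (-α) := by
        rw [Real.rpow_neg hx.le, ← div_eq_mul_inv, one_le_div (by positivity)]
        exact Real.rpow_le_rpow hx.le hxm hα.le
      have := tail_le_one G' x
      have : 0 ≤ C * 2 ^ α * x ^ (-α) := by positivity
      linarith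
    · have h1 : tail G' x ≤ tail G (x / 2) := by
        rw [tail, hG', map_measureReal_apply hsubm (measurableSet_lt_abs x)]
        refine measureReal_mono (fun z hz => ?_) (measure_ne_top _ _)
        simp only [Set.mem_preimage, Set.mem_ofPred_eq] at hz ⊢
        linarith [abs_sub z m, not_le.1 hxm]
      have h2 := h (x / 2) (by positivity)
      rw [Real.div_rpow hx.le two_pos.le, Real.rpow_neg two_pos.le, div_inv_eq_mul] at h2
      have : 0 ≤ (2 * |m|) ^ α * x ^ (-α) := by positivity
      linarith
  have hmean' : ∫ z, z ∂(G' : Measure ℝ) = 0 := by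
    rw [hG', integral_map (f := fun z => z) hsubm.aemeasurable measurable_id.aestronglyMeasurable,
      integral_sub hint (integrable_const m)]
    simp [hm]
  obtain ⟨C, κ, hC, -, hSB⟩ := exists_sumBound hα2 htail' fun _ => hmean'
  set K := (2 * C) ^ (1 / α) with hK
  have hK0 : 0 < K := by positivity
  obtain ⟨K', hK', hev⟩ := hG.tight (η := 1 / 2) (by norm_num)
  have hbound : ∀ᶠ n : ℕ in atTop, |m| ≤ (K + K') * (n : ℝ) ^ (-(1 - 1 / α)) := by
    filter_upwards [hev, eventually_gt_atTop 0] with n hn hn0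
    have hn0' : (0 : ℝ) < n := by exact_mod_cast hn0
    have h1 : (powLaw G n).real {z | K * (n : ℝ) ^ (1 / α) < |∑ i, (z i - m)|} ≤ 1 / 2 := by
      have := hSB.measureReal_le (P := powLaw G n) (X := fun (i : Fin n) z => z i - m) Finset.univ
        (fun i _ => by fun_prop)
        (fun i _ j _ hij => ((iIndepFun_powLaw G n).indepFun hij).comp hsubm hsubm)
        (fun i _ => by
          rw [hG', ← (measurePreserving_eval (fun _ : Fin n => (G : Measure ℝ)) i).map_eq,
            Measure.map_map hsubm (measurable_pi_apply i)]
          rfl)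
        (x := K * (n : ℝ) ^ (1 / α)) (by positivity) (fun h => by linarith)
      refine this.trans (le_of_eq ?_)
      rw [Real.mul_rpow hK0.le (by positivity), hK, ← Real.rpow_mul (by positivity),
        ← Real.rpow_mul hn0'.le, mul_neg, one_div_mul_cancel hα.ne', Real.rpow_neg_one,
        Real.rpow_neg_one, Finset.card_univ, Fintype.card_fin]
      field_simp
    -- The exceptional probabilities are at most 1/2 and strictly below 1/2, so some point avoids
    -- both.
    obtain ⟨z, hz1, hz2⟩ : ∃ z : Fin n → ℝ, |∑ i, (z i - m)| ≤ K * (n : ℝ) ^ (1 / α) ∧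
        |(∑ i, z i) - d n| ≤ K' * (n : ℝ) ^ (1 / α) := by
      by_contra hc
      push Not at hc
      have hcov : (Set.univ : Set (Fin n → ℝ)) ⊆
          {z | K * (n : ℝ) ^ (1 / α) < |∑ i, (z i - m)|} ∪
            {z | K' * (n : ℝ) ^ (1 / α) < |(∑ i, z i) - d n|} := by
        intro z _
        by_cases h : K * (n : ℝ) ^ (1 / α) < |∑ i, (z i - m)|
        · exact Or.inl h
        · exact Or.inr (hc z (not_lt.1 h))
      have := (measureReal_mono hcov (measure_ne_top (powLaw G n) _)).trans
        (measureReal_union_le _ _)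
      rw [probReal_univ] at this
      linarith
    rw [hd n, sub_zero] at hz2
    have hsum : ∑ i, (z i - m) = (∑ i, z i) - n * m := by simp
    rw [hsum] at hz1
    have h2 : n * |m| ≤ (K + K') * (n : ℝ) ^ (1 / α) := by
      have h3 : (n : ℝ) * |m| = |(∑ i, z i) - ((∑ i, z i) - n * m)| := by
        rw [sub_sub_cancel, abs_mul, Nat.abs_cast]
      rw [h3]
      linarith [abs_sub (∑ i, z i) ((∑ i, z i) - n * m)]
    have h4 : (n : ℝ) ^ (-(1 - 1 / α)) = (n : ℝ) ^ (1 / α) / n := by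
      rw [neg_sub, Real.rpow_sub hn0', Real.rpow_one]
    rw [h4, ← mul_div_assoc, le_div_iff₀ hn0']
    linarith
  have hlim : Tendsto (fun n : ℕ => (K + K') * (n : ℝ) ^ (-(1 - 1 / α))) atTop (𝓝 ((K + K') * 0)) :=
    ((tendsto_rpow_neg_atTop (by
      rw [sub_pos, div_lt_one hα]; exact hα1)).comp tendsto_natCast_atTop_atTop).const_mul _
  rw [mul_zero] at hlim
  exact abs_eq_zero.1 (le_antisymm (ge_of_tendsto hlim hbound) (abs_nonneg _))

/-! ### The lower tail estimate by characteristic functions -/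

/-- The centering contributes a factor of modulus one, so norms remove it. This lets the case α = 1,
with arbitrary centering, be treated with the others. -/
theorem norm_charFun_normedSumLaw (G : ProbabilityMeasure ℝ) (α d : ℝ) (n : ℕ) (t : ℝ) :
    ‖charFun (normedSumLaw G α d n : Measure ℝ) t‖ =
      ‖charFun (G : Measure ℝ) (((n : ℝ) ^ (1 / α))⁻¹ * t)‖ ^ n := by
  have h1 : (normedSumLaw G α d n : Measure ℝ) =
      (((powLaw G n).map (∑ i, fun z => z i)).map fun y => y + -d).map
        fun y => ((n : ℝ) ^ (1 / α))⁻¹ * y := by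
    rw [coe_normedSumLaw, Measure.map_map (by fun_prop) (by fun_prop),
      Measure.map_map (by fun_prop) (by fun_prop)]
    congr 1
    funext z
    simp [div_eq_inv_mul, sub_eq_add_neg]
  have h2 := iIndepFun.charFun_map_finsetSum_eq_prod (P := powLaw G n) (s := Finset.univ)
    (X := fun (i : Fin n) z => z i) (fun i _ => (measurable_pi_apply i).aemeasurable)
    ((iIndepFun_powLaw G n).restrict _)
  have h3 : ∀ i : Fin n, (powLaw G n).map (fun z => z i) = (G : Measure ℝ) := fun i =>
    (measurePreserving_eval (fun _ : Fin n => (G : Measure ℝ)) i).map_eq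
  rw [h1, charFun_map_mul, charFun_map_add_const, h2]
  simp only [h3, Finset.prod_const, Finset.card_univ, Fintype.card_fin, Pi.pow_apply, norm_mul,
    norm_pow, Complex.norm_exp_ofReal_mul_I, mul_one]

/-- The left side is at most the integral of 1 - cos(sz), which is at most (sz)²/2 on the truncated
part and 2 beyond it. -/
theorem one_sub_norm_charFun_le (G : ProbabilityMeasure ℝ) {s x : ℝ} (hx : 0 ≤ x) :
    1 - ‖charFun (G : Measure ℝ) s‖ ≤
      s ^ 2 / 2 * (∫ z, trunc x z ^ 2 ∂(G : Measure ℝ)) + 2 * tail G x := by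
  have hre : (charFun (G : Measure ℝ) s).re = ∫ z, Real.cos (s * z) ∂(G : Measure ℝ) := by
    have hi : Integrable (fun z : ℝ => Complex.exp (s * z * Complex.I)) (G : Measure ℝ) := by
      refine Integrable.of_bound (by fun_prop) 1 (Eventually.of_forall fun z => ?_)
      rw [← Complex.ofReal_mul, Complex.norm_exp_ofReal_mul_I]
    rw [charFun_apply_real, ← RCLike.re_eq_complex_re, ← integral_re hi]
    congr 1
    funext z
    rw [RCLike.re_eq_complex_re, ← Complex.ofReal_mul, Complex.exp_ofReal_mul_I_re]
  have h1 : 1 - ‖charFun (G : Measure ℝ) s‖ ≤ ∫ z, (1 - Real.cos (s * z)) ∂(G : Measure ℝ) := by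
    rw [integral_sub (integrable_const _) (Integrable.of_bound (by fun_prop) 1
      (Eventually.of_forall fun z => Real.abs_cos_le_one _)), ← hre]
    have := Complex.re_le_norm (charFun (G : Measure ℝ) s)
    simp only [integral_const, probReal_univ, smul_eq_mul, one_mul]
    linarith
  have hm := measurableSet_lt_abs x
  have hi1 : Integrable (fun z => s ^ 2 / 2 * trunc x z ^ 2) (G : Measure ℝ) := by
    refine Integrable.const_mul (Integrable.of_bound
      ((measurable_trunc x).pow_const 2).aestronglyMeasurable (x ^ 2)
      (Eventually.of_forall fun z => ?_)) _
    rw [Real.norm_eq_abs, abs_pow]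
    exact pow_le_pow_left₀ (abs_nonneg _) (abs_trunc_le_bound hx z) 2
  have hi2 : Integrable (Set.indicator {z : ℝ | x < |z|} fun _ => (2 : ℝ)) (G : Measure ℝ) :=
    (integrable_const _).indicator hm
  refine h1.trans ?_
  calc ∫ z, (1 - Real.cos (s * z)) ∂(G : Measure ℝ)
      ≤ ∫ z, (s ^ 2 / 2 * trunc x z ^ 2 + Set.indicator {z : ℝ | x < |z|} (fun _ => (2 : ℝ)) z)
          ∂(G : Measure ℝ) := by
        refine integral_mono (Integrable.of_bound (by fun_prop) 2
          (Eventually.of_forall fun z => ?_)) (hi1.add hi2) fun z => ?_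
        · rw [Real.norm_eq_abs, abs_le]
          constructor <;> linarith [Real.cos_le_one (s * z), Real.neg_one_le_cos (s * z)]
        · rcases le_or_gt |z| x with h | h
          · have h2 : z ∉ {z : ℝ | x < |z|} := not_lt.2 h
            simp only [trunc_of_le h, Set.indicator_of_notMem h2]
            have := Real.one_sub_sq_div_two_le_cos (x := s * z)
            linarith [mul_pow s z 2]
          · have h2 : z ∈ {z : ℝ | x < |z|} := h
            simp only [trunc_of_lt h, Set.indicator_of_mem h2]
            linarith [Real.neg_one_le_cos (s * z)]
    _ = _ := by
        rw [integral_add hi1 hi2, integral_const_mul, integral_indicator hm, setIntegral_const,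
          smul_eq_mul, mul_comm 2]
        rfl

theorem exp_neg_le_one_sub_half {y : ℝ} (h0 : 0 ≤ y) (h1 : y ≤ 1) : Real.exp (-y) ≤ 1 - y / 2 := by
  rw [Real.exp_neg]
  have h2 : 1 + y ≤ Real.exp y := by linarith [Real.add_one_le_exp y]
  refine (inv_anti₀ (by positivity) h2).trans ?_
  rw [inv_le_iff_one_le_mul₀ (by positivity)]
  nlinarith

/-- The lower tail estimate. -/
theorem InDomainOfNormalAttraction.le_tail {G : ProbabilityMeasure ℝ} {α c : ℝ} {d : ℕ → ℝ}
    (hα : 0 < α) (hα2 : α < 2) (hc : 0 < c) (hG : InDomainOfNormalAttraction G α c d) :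
    ∃ c' : ℝ, 0 < c' ∧ ∀ᶠ x in atTop, c' * x ^ (-α) ≤ tail G x := by
  obtain ⟨C, hC, htr⟩ := exists_integral_trunc_sq_le hα2 (hG.tail_le hα)
  obtain ⟨ν, hν, hlim⟩ := hG
  have hα2' : 0 < 2 - α := by linarith
  -- As α < 2, a small frequency `δ` makes the truncated second moment, of order δ², negligible
  -- against the exponent c δ^α. The remaining loss of modulus must then come from the tail.
  obtain ⟨δ, hδ, hδ1, hδ2⟩ : ∃ δ : ℝ, 0 < δ ∧ c * δ ^ α ≤ 1 ∧ C * δ ^ 2 ≤ c * δ ^ α / 4 := by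
    refine ⟨min ((1 / c) ^ (1 / α)) ((c / (4 * C)) ^ (1 / (2 - α))), by positivity, ?_, ?_⟩
    · set δ := min ((1 / c) ^ (1 / α)) ((c / (4 * C)) ^ (1 / (2 - α)))
      have h1 : δ ^ α ≤ ((1 / c) ^ (1 / α)) ^ α :=
        Real.rpow_le_rpow (by positivity) (min_le_left _ _) hα.le
      rw [← Real.rpow_mul (by positivity), one_div_mul_cancel hα.ne', Real.rpow_one,
        le_div_iff₀ hc] at h1
      linarith
    · set δ := min ((1 / c) ^ (1 / α)) ((c / (4 * C)) ^ (1 / (2 - α)))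
      have hδ : 0 < δ := by positivity
      have h1 : δ ^ (2 - α) ≤ ((c / (4 * C)) ^ (1 / (2 - α))) ^ (2 - α) :=
        Real.rpow_le_rpow (by positivity) (min_le_right _ _) hα2'.le
      rw [← Real.rpow_mul (by positivity), one_div_mul_cancel hα2'.ne', Real.rpow_one,
        le_div_iff₀ (by positivity)] at h1
      have h2 : δ ^ 2 = δ ^ (2 - α) * δ ^ α := by
        rw [← Real.rpow_add hδ, sub_add_cancel, Real.rpow_two]
      have h3 : 0 < δ ^ α := by positivity
      rw [h2]
      nlinarith
  have hcδ : 0 < c * δ ^ α := by positivity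
  have hev : ∀ᶠ n : ℕ in atTop, c * δ ^ α / 16 / n ≤ tail G ((n : ℝ) ^ (1 / α)) := by
    have h1 := ((ProbabilityMeasure.tendsto_iff_tendsto_charFun.1 hlim) δ).norm
    rw [hν δ, abs_of_pos hδ, Complex.norm_exp, Complex.ofReal_re] at h1
    have h2 : Real.exp (-(c * δ ^ α)) < 1 - c * δ ^ α / 4 := by
      linarith [exp_neg_le_one_sub_half hcδ.le hδ1]
    filter_upwards [h1.eventually_lt_const h2, eventually_gt_atTop 0] with n hn hn0
    have hn0' : (0 : ℝ) < n := by exact_mod_cast hn0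
    rw [norm_charFun_normedSumLaw] at hn
    set x := (n : ℝ) ^ (1 / α) with hx
    have hx0 : 0 < x := by positivity
    set φ := ‖charFun (G : Measure ℝ) (x⁻¹ * δ)‖ with hφ
    have hφ0 : 0 ≤ φ := norm_nonneg _
    -- Bernoulli's inequality turns the gap between `φ ^ n` and 1 into a lower bound for `n * (1 -
    -- φ)`.
    have h3 := one_add_mul_le_pow (a := φ - 1) (by linarith) n
    rw [add_sub_cancel] at h3
    have h4 := one_sub_norm_charFun_le G (s := x⁻¹ * δ) hx0.le
    rw [← hφ] at h4
    have h5 : (x⁻¹ * δ) ^ 2 / 2 * (∫ z, trunc x z ^ 2 ∂(G : Measure ℝ)) ≤ c * δ ^ α / 8 / n := by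
      have hxn : x ^ (-α) = (n : ℝ)⁻¹ := by
        rw [hx, ← Real.rpow_mul hn0'.le, mul_neg, one_div_mul_cancel hα.ne', Real.rpow_neg_one]
      have h6 : x ^ (2 - α) = (n : ℝ)⁻¹ * x ^ 2 := by
        rw [sub_eq_neg_add, Real.rpow_add hx0, Real.rpow_two, hxn]
      calc _ ≤ (x⁻¹ * δ) ^ 2 / 2 * (C * x ^ (2 - α)) := by gcongr; exact htr x hx0.le
        _ = C * δ ^ 2 / 2 / n := by rw [h6]; field_simp
        _ ≤ (c * δ ^ α / 4) / 2 / n := by gcongr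
        _ = _ := by ring
    have h7 : c * δ ^ α / 4 / n ≤ 1 - φ := by
      rw [div_le_iff₀ hn0']
      linarith
    have h8 : c * δ ^ α / 4 / n = 2 * (c * δ ^ α / 8 / n) := by ring
    have h9 : c * δ ^ α / 8 / n = 2 * (c * δ ^ α / 16 / n) := by ring
    linarith
  obtain ⟨n₀, hn₀⟩ := eventually_atTop.1 hev
  refine ⟨c * δ ^ α / 32, by positivity, ?_⟩
  filter_upwards [eventually_ge_atTop 1,
    (tendsto_rpow_atTop hα).eventually_ge_atTop (n₀ : ℝ)] with x hx1 hxn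
  have hx0 : 0 < x := by linarith
  set n := ⌈x ^ α⌉₊ with hn
  have hle : x ^ α ≤ n := Nat.le_ceil _
  have hlt : (n : ℝ) < x ^ α + 1 := Nat.ceil_lt_add_one (by positivity)
  have h1 : 1 ≤ x ^ α := Real.one_le_rpow hx1 hα.le
  have hn0 : (0 : ℝ) < n := by linarith
  have h2 : x ≤ (n : ℝ) ^ (1 / α) := by
    calc x = (x ^ α) ^ (1 / α) := by
          rw [← Real.rpow_mul hx0.le, mul_one_div_cancel hα.ne', Real.rpow_one]
      _ ≤ _ := Real.rpow_le_rpow (by positivity) hle (by positivity)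
  have hnn : n₀ ≤ n := by exact_mod_cast hxn.trans hle
  refine le_trans ?_ ((hn₀ n hnn).trans (tail_anti G h2))
  rw [Real.rpow_neg hx0.le, ← div_eq_mul_inv, div_div, div_div, div_le_div_iff₀ (by positivity)
    (by positivity)]
  have : c * δ ^ α * (16 * n) ≤ c * δ ^ α * (16 * (x ^ α * 2)) := by gcongr; linarith
  linarith

/-! ### The integral test for f -/

section

theorem logIntegral_eq_tsum (f : ℝ → ℝ) {Q : ℕ} (hQ : 2 ≤ Q) :
    logIntegral f = ∑' k : ℕ, ∫⁻ x in Set.Ioc ((Q : ℝ) ^ k) ((Q : ℝ) ^ (k + 1)),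
      ENNReal.ofReal (1 / (x * f x)) := by
  have hQ1 : (1 : ℝ) < Q := by exact_mod_cast (by omega : 1 < Q)
  have hmono : Monotone fun k : ℕ => (Q : ℝ) ^ k := fun a b h => pow_le_pow_right₀ hQ1.le h
  have hU : Set.Ioi (1 : ℝ) = ⋃ k : ℕ, Set.Ioc ((Q : ℝ) ^ k) ((Q : ℝ) ^ (k + 1)) := by
    ext x
    simp only [Set.mem_Ioi, Set.mem_iUnion, Set.mem_Ioc]
    constructor
    · intro hx
      classical
      have hex : ∃ k, x ≤ (Q : ℝ) ^ k := ((tendsto_pow_atTop_atTop_of_one_lt hQ1).eventually_ge_atTop x).exists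
      have h1 := Nat.find_spec hex
      have h0 : Nat.find hex ≠ 0 := by
        intro h
        rw [h, pow_zero] at h1
        linarith
      obtain ⟨k, hk⟩ := Nat.exists_eq_succ_of_ne_zero h0
      refine ⟨k, not_le.1 (Nat.find_min hex (m := k) (by omega)), ?_⟩
      rwa [hk] at h1
    · rintro ⟨k, hk, -⟩
      exact (one_le_pow₀ hQ1.le).trans_lt hk
  rw [logIntegral, hU, lintegral_iUnion (fun k => measurableSet_Ioc)]
  exact hmono.pairwise_disjoint_on_Ioc_succ

variable {f : ℝ → ℝ}

theorem one_le_natCast_pow {Q : ℕ} (hQ : 2 ≤ Q) (k : ℕ) : (1 : ℝ) ≤ (Q : ℝ) ^ k :=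
  one_le_pow₀ (by exact_mod_cast (by omega : 1 ≤ Q))

theorem lintegral_Ioc_pow_le (hfpos : ∀ x, 1 ≤ x → 0 < f x) (hfmono : MonotoneOn f (Set.Ici 1))
    {Q : ℕ} (hQ : 2 ≤ Q) (k : ℕ) :
    ∫⁻ x in Set.Ioc ((Q : ℝ) ^ k) ((Q : ℝ) ^ (k + 1)), ENNReal.ofReal (1 / (x * f x)) ≤
      ENNReal.ofReal ((Q - 1) * (1 / f ((Q : ℝ) ^ k))) := by
  have h1 := one_le_natCast_pow hQ k
  have hQ1 : (1 : ℝ) < Q := by exact_mod_cast (by omega : 1 < Q)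
  have hf := hfpos _ h1
  calc _ ≤ ∫⁻ x in Set.Ioc ((Q : ℝ) ^ k) ((Q : ℝ) ^ (k + 1)),
          ENNReal.ofReal (1 / ((Q : ℝ) ^ k * f ((Q : ℝ) ^ k))) := by
        refine setLIntegral_mono' measurableSet_Ioc fun x hx => ENNReal.ofReal_le_ofReal ?_
        exact one_div_le_one_div_of_le (by positivity) (mul_le_mul hx.1.le
          (hfmono h1 (h1.trans hx.1.le) hx.1.le) hf.le (by linarith [hx.1]))
    _ = _ := by
        rw [lintegral_const, Measure.restrict_apply_univ, Real.volume_Ioc,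
          ← ENNReal.ofReal_mul (by positivity)]
        congr 1
        field_simp
        ring

theorem le_lintegral_Ioc_pow (hfpos : ∀ x, 1 ≤ x → 0 < f x) (hfmono : MonotoneOn f (Set.Ici 1))
    {Q : ℕ} (hQ : 2 ≤ Q) (k : ℕ) :
    ENNReal.ofReal ((1 - 1 / Q) * (1 / f ((Q : ℝ) ^ (k + 1)))) ≤
      ∫⁻ x in Set.Ioc ((Q : ℝ) ^ k) ((Q : ℝ) ^ (k + 1)), ENNReal.ofReal (1 / (x * f x)) := by
  have h1 := one_le_natCast_pow hQ k
  have h2 := one_le_natCast_pow hQ (k + 1)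
  have hQ1 : (1 : ℝ) < Q := by exact_mod_cast (by omega : 1 < Q)
  have hf := hfpos _ h2
  calc _ = ∫⁻ x in Set.Ioc ((Q : ℝ) ^ k) ((Q : ℝ) ^ (k + 1)),
          ENNReal.ofReal (1 / ((Q : ℝ) ^ (k + 1) * f ((Q : ℝ) ^ (k + 1)))) := by
        rw [lintegral_const, Measure.restrict_apply_univ, Real.volume_Ioc,
          ← ENNReal.ofReal_mul (by positivity)]
        congr 1
        field_simp
        ring
    _ ≤ _ := by
        refine setLIntegral_mono' measurableSet_Ioc fun x hx => ENNReal.ofReal_le_ofReal ?_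
        have h3 := h1.trans hx.1.le
        have := hfmono h3 h2 hx.2
        have := hfpos x h3
        gcongr
        exact hx.2

/-- Comparison on geometric blocks. The base is arbitrary because in the divergence half f is
evaluated at indices bounded only by a geometric sequence of large ratio. -/
theorem not_summable_of_logIntegral (hfpos : ∀ x, 1 ≤ x → 0 < f x)
    (hfmono : MonotoneOn f (Set.Ici 1)) (h : logIntegral f = ⊤) {Q : ℕ} (hQ : 2 ≤ Q) :
    ¬ Summable fun k : ℕ => 1 / f ((Q : ℝ) ^ k) := by
  intro hs
  have h1 : logIntegral f ≤ ∑' k : ℕ, ENNReal.ofReal ((Q - 1) * (1 / f ((Q : ℝ) ^ k))) := by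
    rw [logIntegral_eq_tsum f hQ]
    exact ENNReal.tsum_le_tsum fun k => lintegral_Ioc_pow_le hfpos hfmono hQ k
  have h2 := (hs.mul_left ((Q : ℝ) - 1)).tsum_ofReal_lt_top
  rw [h, top_le_iff] at h1
  exact h2.ne h1

theorem summable_of_logIntegral (hfpos : ∀ x, 1 ≤ x → 0 < f x)
    (hfmono : MonotoneOn f (Set.Ici 1)) (h : logIntegral f < ⊤) :
    Summable fun k : ℕ => 1 / f ((2 : ℝ) ^ k) := by
  have h1 : ∑' k : ℕ, ENNReal.ofReal ((1 - 1 / (2 : ℕ)) * (1 / f (((2 : ℕ) : ℝ) ^ (k + 1)))) < ⊤ := by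
    refine lt_of_le_of_lt ?_ h
    rw [logIntegral_eq_tsum f le_rfl]
    exact ENNReal.tsum_le_tsum fun k => le_lintegral_Ioc_pow hfpos hfmono le_rfl k
  have h0 : ∀ k : ℕ, 0 < f (((2 : ℕ) : ℝ) ^ k) := fun k => hfpos _ (one_le_natCast_pow le_rfl k)
  have h2 := ENNReal.summable_toReal h1.ne
  have h3 : ∀ k : ℕ, (ENNReal.ofReal ((1 - 1 / (2 : ℕ)) * (1 / f (((2 : ℕ) : ℝ) ^ (k + 1))))).toReal =
      2⁻¹ * (1 / f ((2 : ℝ) ^ (k + 1))) := by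
    intro k
    have := h0 (k + 1)
    rw [ENNReal.toReal_ofReal (mul_nonneg (by norm_num) (by positivity))]
    norm_num
  simp only [h3] at h2
  exact (summable_nat_add_iff 1).1 ((summable_mul_left_iff (by norm_num)).1 h2)

/-- A nonincreasing summable sequence is `o (1 / n)`. -/
theorem tendsto_natCast_mul_of_antitone_of_summable {u : ℕ → ℝ} (hu : Antitone u)
    (hu0 : ∀ k, 0 ≤ u k) (hs : Summable u) : Tendsto (fun n : ℕ => n * u n) atTop (𝓝 0) := by
  -- The tail sum from n / 2 dominates about n / 2 terms, each at least `u n`.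
  have h1 : Tendsto (fun n : ℕ => 2 * ∑' k, u (k + n / 2)) atTop (𝓝 (2 * 0)) :=
    ((tendsto_sum_nat_add u).comp (Nat.tendsto_div_const_atTop two_ne_zero)).const_mul 2
  rw [mul_zero] at h1
  refine squeeze_zero (fun n => mul_nonneg n.cast_nonneg (hu0 n)) (fun n => ?_) h1
  have h2 : ∑ k ∈ Finset.range (n - n / 2), u (k + n / 2) ≤ ∑' k, u (k + n / 2) :=
    ((summable_nat_add_iff (n / 2)).2 hs).sum_le_tsum _ fun k _ => hu0 _
  have h3 : ((n - n / 2 : ℕ) : ℝ) * u n ≤ ∑ k ∈ Finset.range (n - n / 2), u (k + n / 2) := by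
    calc _ = ∑ k ∈ Finset.range (n - n / 2), u n := by simp
      _ ≤ _ := by
        refine Finset.sum_le_sum fun k hk => hu ?_
        have := Finset.mem_range.1 hk
        omega
  have h4 : (n : ℝ) ≤ 2 * ((n - n / 2 : ℕ) : ℝ) := by
    exact_mod_cast (by omega : n ≤ 2 * (n - n / 2))
  nlinarith [hu0 n]

/-- The values 1 / f(2^k) decrease and are summable, hence o(1 / k). This growth controls the
non-governing type and the logarithm at exponent 1. -/
theorem eventually_mul_le_of_logIntegral (hfpos : ∀ x, 1 ≤ x → 0 < f x)
    (hfmono : MonotoneOn f (Set.Ici 1)) (h : logIntegral f < ⊤) (A : ℝ) :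
    ∀ᶠ k : ℕ in atTop, A * k ≤ f ((2 : ℝ) ^ k) := by
  have h1 : ∀ k : ℕ, (1 : ℝ) ≤ 2 ^ k := fun k => one_le_pow₀ one_le_two
  have hanti : Antitone fun k : ℕ => 1 / f ((2 : ℝ) ^ k) := fun a b hab =>
    one_div_le_one_div_of_le (hfpos _ (h1 a))
      (hfmono (h1 a) (h1 b) (pow_le_pow_right₀ one_le_two hab))
  have h2 := (tendsto_natCast_mul_of_antitone_of_summable hanti
    (fun k => (one_div_pos.2 (hfpos _ (h1 k))).le)
    (summable_of_logIntegral hfpos hfmono h)).const_mul |A|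
  rw [mul_zero] at h2
  filter_upwards [h2.eventually_lt_const one_pos] with k hk
  rw [mul_one_div, ← mul_div_assoc, div_lt_one (hfpos _ (h1 k))] at hk
  exact (mul_le_mul_of_nonneg_right (le_abs_self A) k.cast_nonneg).trans hk.le

end

/-! ### Type counts and estimates for one dyadic block -/

section

theorem tau_mono (s : ℕ → Fin 2) (j : Fin 2) : Monotone (tau s j) := fun _ _ h =>
  Finset.card_le_card (Finset.filter_subset_filter _ (Finset.range_mono h))

theorem tau_zero (s : ℕ → Fin 2) (j : Fin 2) : tau s j 0 = 0 := by simp [tau]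

theorem tau_le (s : ℕ → Fin 2) (j : Fin 2) (n : ℕ) : tau s j n ≤ n := by
  simpa [tau] using Finset.card_filter_le (Finset.range n) (fun k => s k = j)

theorem tau_succ_le (s : ℕ → Fin 2) (j : Fin 2) (n : ℕ) : tau s j (n + 1) ≤ tau s j n + 1 := by
  rw [tau, tau, Finset.range_add_one, Finset.filter_insert]
  split_ifs
  · exact Finset.card_insert_le _ _
  · omega

theorem eq_iff_not_eq_of_ne {p q : Fin 2} (hpq : p ≠ q) (i : Fin 2) : i = q ↔ ¬ i = p := by
  revert p q i
  decide

theorem tau_add_tau (s : ℕ → Fin 2) {p q : Fin 2} (hpq : p ≠ q) (n : ℕ) :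
    tau s p n + tau s q n = n := by
  rw [tau, tau, Finset.filter_congr fun k _ => eq_iff_not_eq_of_ne hpq (s k),
    Finset.card_filter_add_card_filter_not, Finset.card_range]

section Convergence

variable {Ω : Type*} [MeasurableSpace Ω] {P : Measure Ω} [IsProbabilityMeasure P]
  {X : ℕ → Ω → ℝ} {s : ℕ → Fin 2} {G : Fin 2 → ProbabilityMeasure ℝ} {p q : Fin 2}
  {α α' C C' κ κ' : ℝ}

theorem SumBound.measureReal_partialSum_le (hX : ∀ k, Measurable (X k)) (hind : iIndepFun X P)
    (hlaw : ∀ k, P.map (X k) = (G (s k) : Measure ℝ)) (hpq : p ≠ q)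
    (hp : SumBound (G p) α C κ) (hq : SumBound (G q) α' C' κ') (m : ℕ) {x : ℝ} (hx : 0 < x)
    (hpm : α = 1 → tau s p m * (1 + Real.log (tau s p m)) ≤ κ * x)
    (hqm : α' = 1 → tau s q m * (1 + Real.log (tau s q m)) ≤ κ' * x) :
    P.real {ω | 2 * x < |partialSum X m ω|} ≤
      C * tau s p m * x ^ (-α) + C' * tau s q m * x ^ (-α') := by
  have h1 := hp.measureReal_le (P := P) (X := X) ((Finset.range m).filter fun k => s k = p)
    (fun i _ => hX i) (fun i _ j _ hij => hind.indepFun hij)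
    (fun i hi => by rw [hlaw, (Finset.mem_filter.1 hi).2]) hx hpm
  have h2 := hq.measureReal_le (P := P) (X := X) ((Finset.range m).filter fun k => s k = q)
    (fun i _ => hX i) (fun i _ j _ hij => hind.indepFun hij)
    (fun i hi => by rw [hlaw, (Finset.mem_filter.1 hi).2]) hx hqm
  have hsum : ∀ ω, partialSum X m ω = ∑ k ∈ (Finset.range m).filter (fun k => s k = p), X k ω +
      ∑ k ∈ (Finset.range m).filter (fun k => s k = q), X k ω := by
    intro ω
    rw [partialSum, ← Finset.sum_filter_add_sum_filter_not _ (fun k => s k = p),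
      Finset.filter_congr fun k _ => eq_iff_not_eq_of_ne hpq (s k)]
  refine le_trans ((measureReal_mono (fun ω hω => ?_) (measure_ne_top P _)).trans
    (measureReal_union_le _ _)) (add_le_add h1 h2)
  by_contra hc
  simp only [Set.mem_union, Set.mem_ofPred_eq, not_or, not_lt] at hω hc
  rw [hsum] at hω
  have := abs_add_le (∑ k ∈ (Finset.range m).filter (fun k => s k = p), X k ω)
    (∑ k ∈ (Finset.range m).filter (fun k => s k = q), X k ω)
  linarith

/-- Both counts increase with the index, so the admissible indices form an initial segment and
Etemadi's inequality applies at its last element. The 6 is Etemadi's 3 times the 2 from splitting by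
type. -/
theorem SumBound.measureReal_exists_partialSum_le (hX : ∀ k, Measurable (X k))
    (hind : iIndepFun X P) (hlaw : ∀ k, P.map (X k) = (G (s k) : Measure ℝ)) (hpq : p ≠ q)
    (hC : 0 ≤ C) (hC' : 0 ≤ C')
    (hp : SumBound (G p) α C κ) (hq : SumBound (G q) α' C' κ') {x N N' : ℝ} (hx : 0 < x)
    (hN0 : 0 ≤ N) (hN0' : 0 ≤ N')
    (hN : α = 1 → ∀ t : ℕ, (t : ℝ) ≤ N → t * (1 + Real.log t) ≤ κ * x)
    (hN' : α' = 1 → ∀ t : ℕ, (t : ℝ) ≤ N' → t * (1 + Real.log t) ≤ κ' * x) :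
    P.real {ω | ∃ m, (tau s p m : ℝ) ≤ N ∧ (tau s q m : ℝ) ≤ N' ∧ 6 * x < |partialSum X m ω|} ≤
      3 * (C * N * x ^ (-α) + C' * N' * x ^ (-α')) := by
  classical
  -- The search bound suffices because the two counts add up to the index.
  set M := Nat.findGreatest (fun m => (tau s p m : ℝ) ≤ N ∧ (tau s q m : ℝ) ≤ N')
    (⌊N⌋₊ + ⌊N'⌋₊) with hM
  have hMspec : (tau s p M : ℝ) ≤ N ∧ (tau s q M : ℝ) ≤ N' :=
    Nat.findGreatest_spec (P := fun m => (tau s p m : ℝ) ≤ N ∧ (tau s q m : ℝ) ≤ N')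
      (Nat.zero_le _) (by simp [tau_zero, hN0, hN0'])
  have hle : ∀ m ≤ M, (tau s p m : ℝ) ≤ N ∧ (tau s q m : ℝ) ≤ N' := fun m hm =>
    ⟨le_trans (by exact_mod_cast tau_mono s p hm) hMspec.1,
      le_trans (by exact_mod_cast tau_mono s q hm) hMspec.2⟩
  have hx' : ∀ β : ℝ, 0 ≤ x ^ (-β) := fun β => (Real.rpow_pos_of_pos hx _).le
  have h1 := measureReal_exists_lt_abs_partialSum_le hX hind M (x := 2 * x)
    (q := C * N * x ^ (-α) + C' * N' * x ^ (-α')) fun m hm => by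
      refine (hp.measureReal_partialSum_le hX hind hlaw hpq hq m hx
        (fun h => hN h _ (hle m hm).1) (fun h => hN' h _ (hle m hm).2)).trans ?_
      have h2 := hx' α
      have h3 := hx' α'
      gcongr
      · exact (hle m hm).1
      · exact (hle m hm).2
  refine le_trans (measureReal_mono (fun ω hω => ?_) (measure_ne_top P _)) h1
  obtain ⟨m, hm1, hm2, hm3⟩ := hω
  refine ⟨m, Nat.le_findGreatest ?_ ⟨hm1, hm2⟩, by linarith⟩
  rw [← tau_add_tau s hpq m]
  exact add_le_add (Nat.le_floor hm1) (Nat.le_floor hm2)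

end Convergence

variable {f : ℝ → ℝ}

/-- The logarithm of an admissible count is O(k), and k^(1-μ) ≤ k^(1/α) is absorbed by f(2^k)^(1/α),
since f(2^k) exceeds every multiple of k. -/
theorem eventually_side_condition {α ε κ D μ : ℝ} (hα : 0 < α) (hε : 0 < ε) (hκ : 0 < κ)
    (hD : 0 < D) (hμ : 0 ≤ μ) (hμα : 1 ≤ μ + 1 / α) (hfpos : ∀ x, 1 ≤ x → 0 < f x)
    (hfmono : MonotoneOn f (Set.Ici 1)) (hlog : logIntegral f < ⊤) :
    ∀ᶠ k : ℕ in atTop, ∀ t : ℕ, (t : ℝ) ≤ D * ((2 : ℝ) ^ k) ^ (1 / α) * (k : ℝ) ^ (-μ) →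
      t * (1 + Real.log t) ≤ κ * (ε * ((2 : ℝ) ^ k * f ((2 : ℝ) ^ k)) ^ (1 / α)) := by
  set A : ℝ := 1 + |Real.log D| + Real.log 2 / α with hA
  have hlog2 : 0 < Real.log 2 := Real.log_pos one_lt_two
  have hA0 : 0 < A := by positivity
  filter_upwards [eventually_mul_le_of_logIntegral hfpos hfmono hlog ((D * A / (κ * ε)) ^ α),
    eventually_ge_atTop 1] with k hk hk1 t ht
  have hk1' : (1 : ℝ) ≤ k := by exact_mod_cast hk1
  have hk0 : (0 : ℝ) < k := by linarith
  have h2k : (0 : ℝ) < 2 ^ k := by positivity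
  have hf0 : 0 < f ((2 : ℝ) ^ k) := hfpos _ (one_le_pow₀ one_le_two)
  set E := ((2 : ℝ) ^ k) ^ (1 / α) with hE
  have hE0 : 0 < E := by positivity
  rcases Nat.eq_zero_or_pos t with rfl | ht0
  · simp only [CharP.cast_eq_zero, zero_mul]
    positivity
  have ht0' : (0 : ℝ) < t := by exact_mod_cast ht0
  have hlogt : 1 + Real.log t ≤ A * k := by
    have h1 : (t : ℝ) ≤ D * E := by
      refine ht.trans (mul_le_of_le_one_right (by positivity) ?_)
      exact Real.rpow_le_one_of_one_le_of_nonpos hk1' (by linarith)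
    have h2 : Real.log t ≤ Real.log D + k * Real.log 2 / α := by
      refine (Real.log_le_log ht0' h1).trans (le_of_eq ?_)
      rw [Real.log_mul hD.ne' hE0.ne', hE, Real.log_rpow h2k, Real.log_pow]
      ring
    have h3 : A * k = k + |Real.log D| * k + k * Real.log 2 / α := by rw [hA]; ring
    have h4 := le_abs_self (Real.log D)
    have h5 := abs_nonneg (Real.log D)
    nlinarith
  have hfk : (D * A / (κ * ε)) * (k : ℝ) ^ (1 / α) ≤ f ((2 : ℝ) ^ k) ^ (1 / α) := by
    have h1 : 0 < D * A / (κ * ε) := by positivity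
    calc _ = ((D * A / (κ * ε)) ^ α * k) ^ (1 / α) := by
          rw [Real.mul_rpow (by positivity) hk0.le, ← Real.rpow_mul h1.le,
            mul_one_div_cancel hα.ne', Real.rpow_one]
      _ ≤ _ := Real.rpow_le_rpow (by positivity) hk (by positivity)
  have hkk : (k : ℝ) ^ (-μ) * k ≤ (k : ℝ) ^ (1 / α) := by
    rw [← Real.rpow_add_one hk0.ne']
    exact Real.rpow_le_rpow_of_exponent_le hk1' (by linarith)
  calc (t : ℝ) * (1 + Real.log t) ≤ (D * E * (k : ℝ) ^ (-μ)) * (A * k) := by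
        refine mul_le_mul ht hlogt ?_ (by positivity)
        have := Real.log_nonneg (by exact_mod_cast ht0 : (1 : ℝ) ≤ t)
        positivity
    _ = D * E * A * ((k : ℝ) ^ (-μ) * k) := by ring
    _ ≤ D * E * A * (k : ℝ) ^ (1 / α) := by gcongr
    _ = κ * (ε * (E * ((D * A / (κ * ε)) * (k : ℝ) ^ (1 / α)))) := by field_simp
    _ ≤ κ * (ε * (E * f ((2 : ℝ) ^ k) ^ (1 / α))) := by gcongr
    _ = _ := by rw [Real.mul_rpow h2k.le hf0.le]

/-- Contribution of the non-governing type: the powers of 2^k cancel, and f(2^k) ≥ k leaves k^(-(μ +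
α'/α)). -/
theorem summable_block_term {α α' ε D μ : ℝ} (hα : 0 < α) (hα' : 0 < α') (hε : 0 < ε) (hD : 0 < D)
    (hμα : 1 < μ + α' / α) (hfpos : ∀ x, 1 ≤ x → 0 < f x)
    (hfmono : MonotoneOn f (Set.Ici 1)) (hlog : logIntegral f < ⊤) :
    Summable fun k : ℕ => D * ((2 : ℝ) ^ k) ^ (α' / α) * (k : ℝ) ^ (-μ) *
      (ε * ((2 : ℝ) ^ k * f ((2 : ℝ) ^ k)) ^ (1 / α)) ^ (-α') := by
  have h1 : Summable fun k : ℕ => D * ε ^ (-α') * (k : ℝ) ^ (-(μ + α' / α)) :=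
    (Real.summable_nat_rpow.2 (by linarith)).mul_left _
  refine Summable.of_norm_bounded_eventually_nat h1 ?_
  filter_upwards [eventually_mul_le_of_logIntegral hfpos hfmono hlog 1,
    eventually_ge_atTop 1] with k hk hk1
  have hk1' : (1 : ℝ) ≤ k := by exact_mod_cast hk1
  have hk0 : (0 : ℝ) < k := by linarith
  have h2k : (0 : ℝ) < 2 ^ k := by positivity
  have hf0 : 0 < f ((2 : ℝ) ^ k) := hfpos _ (one_le_pow₀ one_le_two)
  rw [one_mul] at hk
  rw [Real.norm_of_nonneg (by positivity), Real.mul_rpow hε.le (by positivity),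
    ← Real.rpow_mul (by positivity), Real.mul_rpow h2k.le hf0.le]
  have h3 : 1 / α * -α' = -(α' / α) := by ring
  have h4 : f ((2 : ℝ) ^ k) ^ (-(α' / α)) ≤ (k : ℝ) ^ (-(α' / α)) :=
    Real.rpow_le_rpow_of_nonpos hk0 hk (by rw [neg_nonpos]; positivity)
  have h5 : ((2 : ℝ) ^ k) ^ (α' / α) * ((2 : ℝ) ^ k) ^ (-(α' / α)) = 1 := by
    rw [← Real.rpow_add h2k, add_neg_cancel, Real.rpow_zero]
  rw [h3, neg_add, Real.rpow_add hk0]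
  calc _ = D * ε ^ (-α') * (k : ℝ) ^ (-μ) * f ((2 : ℝ) ^ k) ^ (-(α' / α)) *
        (((2 : ℝ) ^ k) ^ (α' / α) * ((2 : ℝ) ^ k) ^ (-(α' / α))) := by ring
    _ ≤ D * ε ^ (-α') * (k : ℝ) ^ (-μ) * (k : ℝ) ^ (-(α' / α)) * 1 := by
        rw [h5]
        gcongr
    _ = _ := by ring

/-- Contribution of the governing type: each term is exactly a constant times 1 / f(2^k). -/
theorem summable_dominant_block_term {α ε D : ℝ} (hα : 0 < α) (hε : 0 < ε)
    (hfpos : ∀ x, 1 ≤ x → 0 < f x)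
    (hfmono : MonotoneOn f (Set.Ici 1)) (hlog : logIntegral f < ⊤) :
    Summable fun k : ℕ => D * (2 : ℝ) ^ k *
      (ε * ((2 : ℝ) ^ k * f ((2 : ℝ) ^ k)) ^ (1 / α)) ^ (-α) := by
  refine ((summable_of_logIntegral hfpos hfmono hlog).mul_left (D * ε ^ (-α))).congr fun k => ?_
  have h2k : (0 : ℝ) < 2 ^ k := by positivity
  have hf0 : 0 < f ((2 : ℝ) ^ k) := hfpos _ (one_le_pow₀ one_le_two)
  rw [Real.mul_rpow hε.le (by positivity), ← Real.rpow_mul (by positivity), mul_neg,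
    one_div_mul_cancel hα.ne', Real.rpow_neg_one]
  field_simp

theorem limsupE_eq_zero_of_tendsto {u : ℕ → ℝ} (h : Tendsto u atTop (𝓝 0)) : limsupE u = 0 :=
  ((continuous_coe_real_ereal.tendsto 0).comp h).limsup_eq

end

/-! ### The convergence half for deterministic lags -/

theorem ae_eventually_of_summable {Ω : Type*} [MeasurableSpace Ω] {P : Measure Ω}
    [IsProbabilityMeasure P] {A : ℕ → Set Ω} {u : ℕ → ℝ} (hu : Summable u)
    (h : ∀ᶠ k in atTop, P.real (A k) ≤ u k) : ∀ᵐ ω ∂P, ∀ᶠ k in atTop, ω ∉ A k := by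
  have h1 : Summable fun k => P.real (A k) := by
    refine Summable.of_norm_bounded_eventually_nat hu ?_
    filter_upwards [h] with k hk
    rwa [Real.norm_of_nonneg measureReal_nonneg]
  refine ae_eventually_notMem ?_
  have h2 := h1.tsum_ofReal_ne_top
  simpa [ofReal_measureReal] using h2

/-- The convergence half for deterministic lags. -/
theorem ae_limsupE_eq_zero {Ω : Type*} [MeasurableSpace Ω] {P : Measure Ω} [IsProbabilityMeasure P]
    {X : ℕ → Ω → ℝ} {s : ℕ → Fin 2} {G : Fin 2 → ProbabilityMeasure ℝ} {p q : Fin 2}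
    {α α' C C' κ κ' : ℝ} (hX : ∀ k, Measurable (X k)) (hind : iIndepFun X P)
    (hlaw : ∀ k, P.map (X k) = (G (s k) : Measure ℝ)) (hpq : p ≠ q)
    (hα : 0 < α) (hα' : 0 < α') (hC : 0 ≤ C) (hC' : 0 ≤ C') (hκ : 0 < κ) (hκ' : 0 < κ')
    (hp : SumBound (G p) α C κ) (hq : SumBound (G q) α' C' κ')
    {f : ℝ → ℝ} (hfpos : ∀ x, 1 ≤ x → 0 < f x) (hfmono : MonotoneOn f (Set.Ici 1))
    (hlog : logIntegral f < ⊤) (hτ : Tendsto (tau s p) atTop atTop)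
    {b : ℕ → ℕ} {D μ : ℝ} (hD : 0 < D) (hμ : 0 ≤ μ) (hμα : 1 < μ + α' / α)
    (hb : ∀ᶠ n : ℕ in atTop, (tau s p (n + b n) : ℝ) ≤ D * tau s p n)
    (hb' : ∀ᶠ n : ℕ in atTop, (tau s q (n + b n) : ℝ) ≤
      D * (tau s p n : ℝ) ^ (α' / α) * Real.log (tau s p n) ^ (-μ))
    {B : ℕ → ℝ} {c₁ : ℝ} (hc₁ : 0 < c₁)
    (hB : ∀ᶠ n : ℕ in atTop, c₁ * (tau s p n : ℝ) ^ (1 / α) ≤ B n) :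
    ∀ᵐ ω ∂P, limsupE (fun n =>
      |partialSum X (n + b n) ω| / (B n * f (n : ℝ) ^ (1 / α))) = 0 := by
  -- Absorbs replacing τ_p(n) by its dyadic upper bound 2 · 2^k and log τ_p(n) by its lower bound k
  -- log 2.
  set D' := D * 2 ^ (α' / α) * Real.log 2 ^ (-μ) with hD'
  have hlog2 : 0 < Real.log 2 := Real.log_pos one_lt_two
  have hD'0 : 0 < D' := by positivity
  set N : ℕ → ℝ := fun k => 2 * D * (2 : ℝ) ^ k with hN
  set N' : ℕ → ℝ := fun k => D' * ((2 : ℝ) ^ k) ^ (α' / α) * (k : ℝ) ^ (-μ) with hN'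
  set Y : ℕ → ℝ := fun k => ((2 : ℝ) ^ k * f ((2 : ℝ) ^ k)) ^ (1 / α) with hY
  have hf0 : ∀ k : ℕ, 0 < f ((2 : ℝ) ^ k) := fun k => hfpos _ (one_le_pow₀ one_le_two)
  have hY0 : ∀ k, 0 < Y k := fun k => by
    have := hf0 k
    simp only [hY]
    positivity
  have hblocks : ∀ ε : ℝ, 0 < ε → ∀ᵐ ω ∂P, ∀ᶠ k in atTop, ω ∉
      {ω | ∃ m, (tau s p m : ℝ) ≤ N k ∧ (tau s q m : ℝ) ≤ N' k ∧
        6 * (ε * Y k) < |partialSum X m ω|} := by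
    intro ε hε
    refine ae_eventually_of_summable (u := fun k => 3 * (C * (N k * (ε * Y k) ^ (-α)) +
      C' * (N' k * (ε * Y k) ^ (-α')))) ?_ ?_
    · exact (((summable_dominant_block_term hα hε hfpos hfmono hlog).mul_left C).add
        ((summable_block_term hα hα' hε hD'0 hμα hfpos hfmono hlog).mul_left C')).mul_left 3
    · have hs1 : ∀ᶠ k : ℕ in atTop, α = 1 → ∀ t : ℕ, (t : ℝ) ≤ N k →
          t * (1 + Real.log t) ≤ κ * (ε * Y k) := by
        by_cases h : α = 1
        · filter_upwards [eventually_side_condition (κ := κ) hα hε hκ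
            (by positivity : 0 < 2 * D) le_rfl (by rw [h]; norm_num) hfpos hfmono hlog]
            with k hk _ t ht
          refine hk t (ht.trans (le_of_eq ?_))
          simp [hN, h]
        · exact Eventually.of_forall fun k h' => absurd h' h
      have hs2 : ∀ᶠ k : ℕ in atTop, α' = 1 → ∀ t : ℕ, (t : ℝ) ≤ N' k →
          t * (1 + Real.log t) ≤ κ' * (ε * Y k) := by
        by_cases h : α' = 1
        · filter_upwards [eventually_side_condition (κ := κ') hα hε hκ' hD'0 hμ
            (by rw [h] at hμα; exact hμα.le) hfpos hfmono hlog] with k hk _ t ht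
          refine hk t (ht.trans (le_of_eq ?_))
          simp [hN', h]
        · exact Eventually.of_forall fun k h' => absurd h' h
      filter_upwards [hs1, hs2] with k hk1 hk2
      refine (hp.measureReal_exists_partialSum_le hX hind hlaw hpq hC hC' hq
        (mul_pos hε (hY0 k)) (by positivity) (by positivity) hk1 hk2).trans (le_of_eq ?_)
      ring
  -- For k = ⌊log₂ τ_p(n)⌋ the index n + b_n is among those covered by block `k`. The norming
  -- dominates `c₁ * Y k`, because f is nondecreasing and n ≥ τ_p(n) ≥ 2^k.
  have hkey : ∀ᶠ n : ℕ in atTop, 1 ≤ n ∧ 0 < B n ∧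
      (tau s p (n + b n) : ℝ) ≤ N (Nat.log 2 (tau s p n)) ∧
      (tau s q (n + b n) : ℝ) ≤ N' (Nat.log 2 (tau s p n)) ∧
      c₁ * Y (Nat.log 2 (tau s p n)) ≤ B n * f n ^ (1 / α) := by
    filter_upwards [hb, hb', hB, hτ.eventually_ge_atTop 2, eventually_ge_atTop 1]
      with n h1 h2 h3 h4 hn1
    set t := tau s p n with ht
    set k := Nat.log 2 t with hk
    have hlo : (2 : ℝ) ^ k ≤ t := by exact_mod_cast Nat.pow_log_le_self 2 (by omega)
    have hhi : (t : ℝ) ≤ 2 * 2 ^ k := by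
      rw [← pow_succ']
      exact_mod_cast (Nat.lt_pow_succ_log_self one_lt_two t).le
    have hk1 : 1 ≤ k := Nat.log_pos one_lt_two h4
    have hk0 : (0 : ℝ) < k := by exact_mod_cast hk1
    have ht0 : (0 : ℝ) < t := by exact_mod_cast (by omega : 0 < t)
    have hlogt : k * Real.log 2 ≤ Real.log t := by
      rw [← Real.log_pow]
      exact Real.log_le_log (by positivity) hlo
    have htn : (t : ℝ) ≤ n := by exact_mod_cast tau_le s p n
    have hffn : f ((2 : ℝ) ^ k) ≤ f n :=
      hfmono (one_le_pow₀ one_le_two : (1 : ℝ) ≤ 2 ^ k) (by exact_mod_cast hn1 : (1 : ℝ) ≤ n)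
        (hlo.trans htn)
    refine ⟨hn1, lt_of_lt_of_le (by positivity) h3, ?_, ?_, ?_⟩
    · refine h1.trans ?_
      calc D * t ≤ D * (2 * 2 ^ k) := by gcongr
        _ = _ := by simp only [hN]; ring
    · refine h2.trans ?_
      calc D * (t : ℝ) ^ (α' / α) * Real.log t ^ (-μ)
          ≤ D * (2 * 2 ^ k) ^ (α' / α) * (k * Real.log 2) ^ (-μ) := by
            have h6 : Real.log t ^ (-μ) ≤ (k * Real.log 2) ^ (-μ) :=
              Real.rpow_le_rpow_of_nonpos (by positivity) hlogt (by linarith)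
            have h7 : 0 ≤ Real.log t ^ (-μ) :=
              Real.rpow_nonneg ((by positivity : 0 ≤ k * Real.log 2).trans hlogt) _
            gcongr
        _ = _ := by
            simp only [hN', hD']
            rw [Real.mul_rpow zero_le_two (by positivity), Real.mul_rpow hk0.le hlog2.le]
            ring
    · have h5 := hf0 k
      calc c₁ * Y k = c₁ * ((2 : ℝ) ^ k) ^ (1 / α) * f ((2 : ℝ) ^ k) ^ (1 / α) := by
            simp only [hY]
            rw [Real.mul_rpow (by positivity) h5.le, mul_assoc]
        _ ≤ c₁ * (t : ℝ) ^ (1 / α) * f n ^ (1 / α) := by gcongr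
        _ ≤ _ := by
            have := (h5.trans_le hffn).le
            gcongr
  -- The level is chosen so that the normed sums are eventually at most 1 / (j + 1).
  have hae : ∀ᵐ ω ∂P, ∀ j : ℕ, ∀ᶠ k in atTop, ω ∉
      {ω | ∃ m, (tau s p m : ℝ) ≤ N k ∧ (tau s q m : ℝ) ≤ N' k ∧
        6 * (c₁ / (6 * (j + 1)) * Y k) < |partialSum X m ω|} :=
    ae_all_iff.2 fun j => hblocks _ (by positivity)
  have hlogτ : Tendsto (fun n => Nat.log 2 (tau s p n)) atTop atTop := by
    refine Tendsto.comp (g := Nat.log 2) (tendsto_atTop.2 fun k => ?_) hτ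
    filter_upwards [eventually_ge_atTop (2 ^ k)] with t ht
    exact Nat.le_log_of_pow_le one_lt_two ht
  filter_upwards [hae] with ω hω
  refine limsupE_eq_zero_of_tendsto (tendsto_order.2 ⟨fun y hy => ?_, fun y hy => ?_⟩)
  · filter_upwards [hkey] with n hn
    obtain ⟨hn1, hB0, -⟩ := hn
    have := hfpos n (by exact_mod_cast hn1)
    exact hy.trans_le (by positivity)
  · obtain ⟨j, hj⟩ := exists_nat_one_div_lt hy
    filter_upwards [hkey, hlogτ.eventually (hω j)] with n hn h4
    obtain ⟨hn1, hB0, h1, h2, h3⟩ := hn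
    have := hfpos n (by exact_mod_cast hn1)
    refine lt_of_le_of_lt ?_ hj
    have h5 : |partialSum X (n + b n) ω| ≤ 6 * (c₁ / (6 * (j + 1)) * Y (Nat.log 2 (tau s p n))) := by
      by_contra hc
      exact h4 ⟨n + b n, h1, h2, not_le.1 hc⟩
    rw [div_le_div_iff₀ (by positivity) (by positivity), one_mul]
    have h6 : 6 * (c₁ / (6 * (j + 1)) * Y (Nat.log 2 (tau s p n))) * ((j : ℝ) + 1) =
        c₁ * Y (Nat.log 2 (tau s p n)) := by
      field_simp
    calc _ ≤ 6 * (c₁ / (6 * (j + 1)) * Y (Nat.log 2 (tau s p n))) * ((j : ℝ) + 1) := by gcongr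
      _ ≤ _ := by rwa [h6]

/-! ### The divergence half for deterministic lags -/

section Blocks

variable {Ω : Type*} [MeasurableSpace Ω] {P : Measure Ω} [IsProbabilityMeasure P]
  {X : ℕ → Ω → ℝ}

/-- Events depending on disjoint consecutive blocks are independent. -/
theorem iIndepSet_blocks (hX : ∀ k, Measurable (X k)) (hind : iIndepFun X P) {m : ℕ → ℕ}
    (hm : Monotone m) (y : ℕ → ℝ) :
    iIndepSet (fun k => {ω | y k < |∑ i ∈ Finset.Ico (m k) (m (k + 1)), X i ω|}) P := by
  have hA : ∀ (T : Set ℕ) (k : ℕ), (∀ i, m k ≤ i → i < m (k + 1) → i ∈ T) →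
      MeasurableSet[⨆ i ∈ T, MeasurableSpace.comap (X i) inferInstance]
        {ω | y k < |∑ i ∈ Finset.Ico (m k) (m (k + 1)), X i ω|} := by
    intro T k hT
    have h1 : Measurable[⨆ i ∈ T, MeasurableSpace.comap (X i) inferInstance]
        (fun ω => ∑ i ∈ Finset.Ico (m k) (m (k + 1)), X i ω) := by
      refine Finset.measurable_sum _ fun i hi => (comap_measurable (X i)).mono ?_ le_rfl
      have hi' := Finset.mem_Ico.1 hi
      exact le_iSup₂ (f := fun i (_ : i ∈ T) => MeasurableSpace.comap (X i) inferInstance) i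
        (hT i hi'.1 hi'.2)
    exact h1 (measurableSet_lt_abs (y k))
  have hAm : ∀ k, MeasurableSet {ω | y k < |∑ i ∈ Finset.Ico (m k) (m (k + 1)), X i ω|} := fun k =>
    measurableSet_lt measurable_const (Finset.measurable_sum _ fun i _ => hX i).abs
  rw [iIndepSet_iff_meas_biInter hAm]
  intro S
  -- Adding the largest index last, all earlier events depend only on variables before its block.
  induction S using Finset.induction_on_max with
  | empty => simp
  | insert a S ha ih =>
    have haS : a ∉ S := fun h => (ha a h).false
    rw [Finset.prod_insert haS, Finset.set_biInter_insert, ← ih, Set.inter_comm, mul_comm]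
    have hI : Indep (⨆ k ∈ {k | k < m a}, MeasurableSpace.comap (X k) inferInstance)
        (⨆ k ∈ {k | m a ≤ k}, MeasurableSpace.comap (X k) inferInstance) P :=
      indep_iSup_of_disjoint (fun k => (hX k).comap_le) hind
        (Set.disjoint_left.2 fun k h1 h2 => by simp at h1 h2; omega)
    refine (Indep_iff _ _ P).1 hI _ _ ?_ (hA _ a fun i hi _ => hi)
    refine Finset.measurableSet_biInter _ fun k hk => hA _ k fun i _ hi => ?_
    exact hi.trans_le (hm (ha k hk))

theorem card_filter_Ico (s : ℕ → Fin 2) (p : Fin 2) {a b : ℕ} (hab : a ≤ b) :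
    ((Finset.Ico a b).filter fun k => s k = p).card = tau s p b - tau s p a := by
  have h : (Finset.range b).filter (fun k => s k = p) =
      (Finset.range a).filter (fun k => s k = p) ∪ (Finset.Ico a b).filter (fun k => s k = p) := by
    rw [← Finset.filter_union]
    congr 1
    ext k
    simp
    omega
  rw [tau, tau, h, Finset.card_union_of_disjoint, Nat.add_sub_cancel_left]
  exact Finset.disjoint_filter_filter (Finset.disjoint_left.2 fun k h1 h2 => by
    simp at h1 h2
    omega)

/-- A block containing many summands of one type is large with a probability comparable to the
expected number of its large summands. -/
theorem min_le_measureReal_block {s : ℕ → Fin 2} {G : Fin 2 → ProbabilityMeasure ℝ} {p : Fin 2}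
    (hX : ∀ k, Measurable (X k)) (hind : iIndepFun X P)
    (hlaw : ∀ k, P.map (X k) = (G (s k) : Measure ℝ)) {a b c : ℕ} (hab : a ≤ b) (hbc : b ≤ c)
    {y : ℝ} (h2 : tail (G p) (2 * y) ≤ 1 / 4)
    (h4 : (tau s p b - tau s p a : ℕ) * tail (G p) (4 * y) ≤ 1 / 8) :
    min (1 / 2) ((tau s p b - tau s p a : ℕ) * tail (G p) (4 * y) / 8) ≤
      P.real {ω | y < |∑ i ∈ Finset.Ico a c, X i ω|} := by
  rw [← card_filter_Ico s p hab] at h4 ⊢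
  have htail : ∀ i ∈ (Finset.Ico a b).filter (fun k => s k = p), ∀ x,
      P.real {ω | x < |X i ω|} = tail (G p) x := by
    intro i hi x
    rw [tail, ← (Finset.mem_filter.1 hi).2, ← hlaw i,
      map_measureReal_apply (hX i) (measurableSet_lt_abs x)]
    rfl
  refine min_le_measureReal_lt_abs (X := X) _ (fun i _ => hX i)
    (Finset.measurable_sum _ fun i _ => hX i) (fun i _ j _ hij => hind.indepFun hij) ?_
    (fun i hi => htail i hi _) (fun i hi => (htail i hi _).trans_le h2) h4
  intro i hi
  have hic : i ∈ Finset.Ico a c := by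
    have := Finset.mem_Ico.1 (Finset.mem_filter.1 hi).1
    exact Finset.mem_Ico.2 ⟨this.1, this.2.trans_le hbc⟩
  have h := (hind.indepFun_finsetSum_of_notMem hX (Finset.notMem_erase i (Finset.Ico a c))).symm
  refine h.congr (Eventually.of_forall fun ω => rfl) (Eventually.of_forall fun ω => ?_)
  have := Finset.add_sum_erase (Finset.Ico a c) (fun j => X j ω) hic
  simp only [Finset.sum_apply]
  linarith

end Blocks

/-- The count starts at 0, grows by at most one per step and is unbounded, so no value is skipped.
-/
theorem exists_tau_eq (s : ℕ → Fin 2) (p : Fin 2) (hτ : Tendsto (tau s p) atTop atTop) {r : ℕ} :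
    ∃ n, tau s p n = r := by
  classical
  have hex : ∃ n, r ≤ tau s p n := (hτ.eventually_ge_atTop r).exists
  refine ⟨Nat.find hex, le_antisymm ?_ (Nat.find_spec hex)⟩
  by_contra hc
  push Not at hc
  have h0 : Nat.find hex ≠ 0 := by
    intro h
    rw [h, tau_zero] at hc
    omega
  obtain ⟨k, hk⟩ := Nat.exists_eq_succ_of_ne_zero h0
  have h1 := Nat.find_min hex (m := k) (by omega)
  have h2 := tau_succ_le s p k
  rw [hk, Nat.succ_eq_add_one] at hc
  omega

theorem limsupE_eq_top {u : ℕ → ℝ} (h : ∀ j : ℕ, ∃ᶠ n in atTop, (j : ℝ) ≤ u n) :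
    limsupE u = ⊤ := by
  refine EReal.eq_top_iff_forall_lt _ |>.2 fun y => ?_
  obtain ⟨j, hj⟩ := exists_nat_gt y
  refine lt_of_lt_of_le (EReal.coe_lt_coe_iff.2 hj) ?_
  exact le_limsup_of_frequently_le ((h j).mono fun n hn => EReal.coe_le_coe_iff.2 hn)
    (by isBoundedDefault)

/-- The divergence half for deterministic lags. -/
theorem ae_limsupE_eq_top {Ω : Type*} [MeasurableSpace Ω] {P : Measure Ω} [IsProbabilityMeasure P]
    {X : ℕ → Ω → ℝ} {s : ℕ → Fin 2} {G : Fin 2 → ProbabilityMeasure ℝ} {p : Fin 2}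
    {α : ℝ} (hX : ∀ k, Measurable (X k)) (hind : iIndepFun X P)
    (hlaw : ∀ k, P.map (X k) = (G (s k) : Measure ℝ)) (hα : 0 < α)
    (hup : ∃ C : ℝ, 0 < C ∧ ∀ x, 0 < x → tail (G p) x ≤ C * x ^ (-α))
    (hlow : ∃ c : ℝ, 0 < c ∧ ∀ᶠ x in atTop, c * x ^ (-α) ≤ tail (G p) x)
    {f : ℝ → ℝ} (hfpos : ∀ x, 1 ≤ x → 0 < f x) (hfmono : MonotoneOn f (Set.Ici 1))
    (hlog : logIntegral f = ⊤) (hτ : Tendsto (tau s p) atTop atTop)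
    {b : ℕ → ℕ} {D : ℝ}
    (hb : ∀ᶠ n : ℕ in atTop, (tau s p (n + b n) : ℝ) ≤ D * tau s p n)
    {κ : ℕ} (hκ : κ ≠ 0) (hn : ∀ᶠ n : ℕ in atTop, n ≤ tau s p n ^ κ)
    {B : ℕ → ℝ} {c₂ : ℝ} (hc₂ : 0 < c₂)
    (hB : ∀ᶠ n : ℕ in atTop, 0 < B n ∧ B n ≤ c₂ * (tau s p n : ℝ) ^ (1 / α)) :
    ∀ᵐ ω ∂P, limsupE (fun n =>
      |partialSum X (n + b n) ω| / (B n * f (n : ℝ) ^ (1 / α))) = ⊤ := by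
  obtain ⟨C, hC, hup⟩ := hup
  obtain ⟨c, hc, hlow⟩ := hlow
  obtain ⟨k₀, hk₀⟩ := eventually_atTop.1 (hb.and (hn.and (hB.and (eventually_ge_atTop 1))))
  -- With this ratio the lag from n_k uses at most half of the type-p variables before n_{k+1}; the
  -- other half lies between n_k + b(n_k) and n_{k+1}.
  obtain ⟨R, hRD⟩ : ∃ R : ℕ, 2 ≤ R ∧ 2 * D ≤ R := by
    obtain ⟨R, hR⟩ := exists_nat_ge (2 * D)
    exact ⟨R + 2, by omega, by push_cast; linarith⟩
  obtain ⟨hR2, hRD⟩ := hRD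
  have hR1 : (1 : ℝ) ≤ R := by exact_mod_cast (by omega : 1 ≤ R)
  have hf1 : 0 < f 1 := hfpos 1 le_rfl
  choose n hnτ using fun k : ℕ => exists_tau_eq s p hτ (r := R ^ (k + k₀))
  have hnk : ∀ k, k + k₀ ≤ n k := fun k =>
    (Nat.lt_pow_self (by omega : 1 < R)).le.trans ((hnτ k).symm.trans_le (tau_le s p _))
  have hn1 : ∀ k, 1 ≤ n k := fun k => (hk₀ (n k) (by have := hnk k; omega)).2.2.2
  set m : ℕ → ℕ := fun k => n k + b (n k) with hm
  have hτm : ∀ k, 2 * tau s p (m k) ≤ R ^ (k + 1 + k₀) := by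
    intro k
    have h1 := (hk₀ (n k) (by have := hnk k; omega)).1
    rw [hnτ k] at h1
    have h2 : (2 * tau s p (m k) : ℝ) ≤ R ^ (k + 1 + k₀) := by
      have h3 : (R : ℝ) ^ (k + 1 + k₀) = R * R ^ (k + k₀) := by rw [← pow_succ']; ring_nf
      have h4 : (0 : ℝ) ≤ R ^ (k + k₀) := by positivity
      rw [h3]
      push_cast at h1
      have h5 := mul_le_mul_of_nonneg_right hRD h4
      simp only [hm]
      linarith
    exact_mod_cast h2
  have hmn : ∀ k, m k ≤ n (k + 1) := by
    intro k
    by_contra hc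
    have h1 := tau_mono s p (not_le.1 hc).le
    have h2 := hτm k
    rw [hnτ] at h1
    have h3 : 0 < R ^ (k + 1 + k₀) := by positivity
    omega
  have hmmono : Monotone m := monotone_nat_of_le_succ fun k => (hmn k).trans (Nat.le_add_right _ _)
  have hnmono : Monotone n := monotone_nat_of_le_succ fun k => (Nat.le_add_right _ _).trans (hmn k)
  set z : ℕ → ℝ := fun k => ((R : ℝ) ^ (k + k₀) * f (n k)) ^ (1 / α) with hz
  have hfn : ∀ k, 0 < f (n k) := fun k => hfpos _ (by exact_mod_cast hn1 k)
  have hfn1 : ∀ k, f 1 ≤ f (n k) := fun k =>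
    hfmono (le_refl (1 : ℝ)) (by exact_mod_cast hn1 k : (1 : ℝ) ≤ n k) (by exact_mod_cast hn1 k)
  have hz0 : ∀ k, 0 < z k := fun k => by have := hfn k; simp only [hz]; positivity
  have hzmono : Monotone z := by
    intro i j hij
    have h1 : f (n i) ≤ f (n j) := hfmono (by exact_mod_cast hn1 i : (1 : ℝ) ≤ n i)
      (by exact_mod_cast hn1 j : (1 : ℝ) ≤ n j) (by exact_mod_cast hnmono hij)
    have := hfn i
    simp only [hz]
    gcongr
  have hzα : ∀ (r : ℝ) (k : ℕ), 0 < r → (r * z k) ^ (-α) =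
      r ^ (-α) / (R ^ (k + k₀) * f (n k)) := by
    intro r k hr
    have := hfn k
    rw [Real.mul_rpow hr.le (hz0 k).le]
    simp only [hz]
    rw [← Real.rpow_mul (by positivity), mul_neg, one_div_mul_cancel hα.ne', Real.rpow_neg_one,
      div_eq_mul_inv]
  have hlarge : ∀ᶠ M : ℝ in atTop, ∀ᵐ ω ∂P, ∃ᶠ k in atTop,
      M * z (k + 1) < |∑ i ∈ Finset.Ico (m k) (m (k + 1)), X i ω| := by
    have ht : ∀ r : ℝ, 0 < r → Tendsto (fun M : ℝ => C * (r * M) ^ (-α) / f 1) atTop (𝓝 0) := by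
      intro r hr
      have h1 := ((tendsto_rpow_neg_atTop hα).comp (tendsto_id.const_mul_atTop hr))
      simpa using (h1.const_mul C).div_const (f 1)
    obtain ⟨x₀, hx₀⟩ := eventually_atTop.1 hlow
    -- `M` is so large that the upper tail estimate meets the smallness conditions of the
    -- single-jump inequality and that `4 * M * z (k + 1)` lies where the lower tail estimate holds.
    filter_upwards [(ht 2 two_pos).eventually_le_const (by norm_num : (0 : ℝ) < 1 / 4),
      (ht 4 four_pos).eventually_le_const (by norm_num : (0 : ℝ) < 1 / 8), eventually_gt_atTop 0,
      eventually_ge_atTop (x₀ / (4 * f 1 ^ (1 / α)))] with M h2 h4 hM0 hMx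
    set A : ℕ → Set Ω := fun k =>
      {ω | M * z (k + 1) < |∑ i ∈ Finset.Ico (m k) (m (k + 1)), X i ω|} with hA
    -- The entries match the two branches of the minimum in the block bound; in the second, 16 is 2
    -- from the half count times 8.
    set c' : ℝ := min (f 1 / 2) (c * (4 * M) ^ (-α) / 16) with hc'
    have hc'0 : 0 < c' := by positivity
    have hPA : ∀ k, c' * (1 / f (((R ^ κ : ℕ) : ℝ) ^ (k + 1 + k₀))) ≤ P.real (A k) := by
      intro k
      have hfk := hfn (k + 1)
      have hfk1 := hfn1 (k + 1)
      have hRk : (0 : ℝ) < R ^ (k + 1 + k₀) := by positivity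
      have hRk1 : (1 : ℝ) ≤ R ^ (k + 1 + k₀) := one_le_pow₀ hR1
      have hupr : ∀ r : ℝ, 0 < r → tail (G p) (r * (M * z (k + 1))) ≤
          C * (r * M) ^ (-α) / f 1 / R ^ (k + 1 + k₀) := by
        intro r hr
        have hzk := hz0 (k + 1)
        refine (hup _ (by positivity)).trans ?_
        rw [← mul_assoc, hzα _ _ (by positivity), div_div, ← mul_div_assoc, mul_comm (f 1)]
        gcongr
      have hcardle : ((tau s p (n (k + 1)) - tau s p (m k) : ℕ) : ℝ) ≤ R ^ (k + 1 + k₀) := by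
        rw [hnτ]
        exact_mod_cast Nat.sub_le _ _
      have hcardge : (R : ℝ) ^ (k + 1 + k₀) / 2 ≤
          ((tau s p (n (k + 1)) - tau s p (m k) : ℕ) : ℝ) := by
        rw [hnτ]
        have h5 : R ^ (k + 1 + k₀) ≤ 2 * (R ^ (k + 1 + k₀) - tau s p (m k)) := by
          have := hτm k
          omega
        have h6 : (R : ℝ) ^ (k + 1 + k₀) ≤ 2 * ((R ^ (k + 1 + k₀) - tau s p (m k) : ℕ) : ℝ) := by
          exact_mod_cast h5
        linarith
      have hblock := min_le_measureReal_block (P := P) (s := s) (G := G) (p := p) hX hind hlaw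
        (hmn k) (Nat.le_add_right (n (k + 1)) (b (n (k + 1)))) (y := M * z (k + 1))
        ((hupr 2 two_pos).trans ((div_le_self (by positivity) hRk1).trans h2))
        (by
          calc _ ≤ (R : ℝ) ^ (k + 1 + k₀) * (C * (4 * M) ^ (-α) / f 1 / R ^ (k + 1 + k₀)) :=
                mul_le_mul hcardle (hupr 4 four_pos) (tail_nonneg _ _) hRk.le
            _ = C * (4 * M) ^ (-α) / f 1 := by field_simp
            _ ≤ _ := h4)
      refine le_trans (le_trans (b := c' * (1 / f (n (k + 1)))) ?_ (le_min ?_ ?_)) hblock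
      -- Since n ≤ τ_p(n)^κ, the indices n_k grow at most geometrically, with ratio R^κ, and the
      -- integral test in that base applies.
      · have h5 : (n (k + 1) : ℝ) ≤ ((R ^ κ : ℕ) : ℝ) ^ (k + 1 + k₀) := by
          have h6 := (hk₀ (n (k + 1)) (by have := hnk (k + 1); omega)).2.1
          rw [hnτ, ← pow_mul, mul_comm, pow_mul] at h6
          exact_mod_cast h6
        have h7 := hfmono (by exact_mod_cast hn1 (k + 1) : (1 : ℝ) ≤ n (k + 1))
          ((by exact_mod_cast hn1 (k + 1) : (1 : ℝ) ≤ n (k + 1)).trans h5) h5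
        gcongr
      · rw [mul_one_div, div_le_iff₀ hfk]
        linarith [min_le_left (f 1 / 2) (c * (4 * M) ^ (-α) / 16)]
      · have h5 : c * ((4 * M) ^ (-α) / (R ^ (k + 1 + k₀) * f (n (k + 1)))) ≤
            tail (G p) (4 * (M * z (k + 1))) := by
          have h6 := hx₀ (4 * (M * z (k + 1))) (by
            rw [div_le_iff₀ (by positivity)] at hMx
            have h7 : f 1 ^ (1 / α) ≤ z (k + 1) := by
              refine Real.rpow_le_rpow hf1.le ?_ (by positivity)
              nlinarith
            have h8 := mul_le_mul_of_nonneg_left h7 hM0.le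
            linarith)
          rwa [← mul_assoc 4 M, hzα _ _ (by positivity), mul_assoc 4 M] at h6
        calc c' * (1 / f (n (k + 1))) ≤ (c * (4 * M) ^ (-α) / 16) * (1 / f (n (k + 1))) := by
              gcongr
              exact min_le_right _ _
          _ = ((R : ℝ) ^ (k + 1 + k₀) / 2) *
              (c * ((4 * M) ^ (-α) / (R ^ (k + 1 + k₀) * f (n (k + 1))))) / 8 := by
              field_simp
              norm_num
          _ ≤ _ := by
              gcongr
    have hsum : ∑' k, P (A k) = ⊤ := by
      by_contra hne
      have h5 := ENNReal.summable_toReal hne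
      have h6 : Summable fun k : ℕ => c' * (1 / f (((R ^ κ : ℕ) : ℝ) ^ (k + (1 + k₀)))) := by
        refine Summable.of_nonneg_of_le (fun k => ?_) (fun k => ?_) h5
        · have := hfpos (((R ^ κ : ℕ) : ℝ) ^ (k + (1 + k₀)))
            (one_le_pow₀ (by exact_mod_cast Nat.one_le_pow _ _ (by omega)))
          positivity
        · rw [← add_assoc]
          exact hPA k
      refine not_summable_of_logIntegral hfpos hfmono hlog (Q := R ^ κ)
        (hR2.trans (Nat.le_self_pow hκ R)) ?_
      exact (summable_nat_add_iff (1 + k₀)).1 ((summable_mul_left_iff hc'0.ne').1 h6)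
    have hAm : ∀ k, MeasurableSet (A k) := fun k =>
      measurableSet_lt measurable_const (Finset.measurable_sum _ fun i _ => hX i).abs
    have h1 := measure_limsup_eq_one hAm (iIndepSet_blocks hX hind hmmono _) hsum
    have h3 : ∀ᵐ ω ∂P, ω ∈ limsup A atTop :=
      (mem_ae_iff_prob_eq_one (MeasurableSet.measurableSet_limsup hAm)).2 h1
    filter_upwards [h3] with ω hω
    exact Filter.mem_limsup_iff_frequently_mem.1 hω
  obtain ⟨M₀, hM₀⟩ := eventually_atTop.1 hlarge
  -- Twice the target level `c₂ * j`: an increment this large forces one of its two end sums above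
  -- the target, and `z` is nondecreasing. Adding `|M₀|` keeps the level in the admissible range.
  have hall : ∀ᵐ ω ∂P, ∀ j : ℕ, ∃ᶠ k in atTop,
      (|M₀| + 2 * c₂ * j) * z (k + 1) < |∑ i ∈ Finset.Ico (m k) (m (k + 1)), X i ω| :=
    ae_all_iff.2 fun j => hM₀ _ (by
      have : 0 ≤ 2 * c₂ * j := by positivity
      linarith [le_abs_self M₀])
  filter_upwards [hall] with ω hω
  refine limsupE_eq_top fun j => ?_
  have h1 : ∃ᶠ k in atTop, c₂ * j * z k < |partialSum X (m k) ω| := by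
    rw [frequently_atTop]
    intro N
    obtain ⟨k, hk, hkN⟩ := ((hω j).and_eventually (eventually_ge_atTop N)).exists
    have h2 : ∑ i ∈ Finset.Ico (m k) (m (k + 1)), X i ω =
        partialSum X (m (k + 1)) ω - partialSum X (m k) ω :=
      Finset.sum_Ico_eq_sub _ (hmmono k.le_succ)
    rw [h2] at hk
    have h3 := abs_sub (partialSum X (m (k + 1)) ω) (partialSum X (m k) ω)
    have h4 : 0 ≤ |M₀| * z (k + 1) := mul_nonneg (abs_nonneg _) (hz0 _).le
    by_cases h5 : c₂ * j * z (k + 1) < |partialSum X (m (k + 1)) ω|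
    · exact ⟨k + 1, by omega, h5⟩
    · refine ⟨k, hkN, ?_⟩
      have h6 : c₂ * j * z k ≤ c₂ * j * z (k + 1) :=
        mul_le_mul_of_nonneg_left (hzmono k.le_succ) (by positivity)
      push Not at h5
      linarith
  have hntop : Tendsto n atTop atTop :=
    tendsto_atTop_mono (fun k => (Nat.le_add_right k k₀).trans (hnk k)) tendsto_id
  refine hntop.frequently (h1.mono fun k hk => ?_)
  obtain ⟨hB0, hB1⟩ := (hk₀ (n k) (by have := hnk k; omega)).2.2.1
  have hf0 := hfn k
  rw [le_div_iff₀ (by positivity)]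
  refine le_trans ?_ hk.le
  have h7 : z k = (tau s p (n k) : ℝ) ^ (1 / α) * f (n k) ^ (1 / α) := by
    simp only [hz]
    rw [hnτ, Real.mul_rpow (by positivity) hf0.le, Nat.cast_pow]
  calc (j : ℝ) * (B (n k) * f (n k) ^ (1 / α))
      ≤ j * (c₂ * (tau s p (n k) : ℝ) ^ (1 / α) * f (n k) ^ (1 / α)) := by gcongr
    _ = _ := by rw [h7]; ring

/-! ### Random lags and the joining of both halves -/

theorem measurable_limsupE {γ : Type*} [MeasurableSpace γ] {u : ℕ → γ → ℝ}
    (hu : ∀ n, Measurable (u n)) : Measurable fun c => limsupE fun n => u n c :=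
  Measurable.limsup fun n => measurable_coe_real_ereal.comp (hu n)

/-- Random lags independent of the summands may be replaced by deterministic ones. -/
theorem ae_limsupE_random_lag {Ω : Type*} [MeasurableSpace Ω] {P : Measure Ω}
    [IsProbabilityMeasure P] {X : ℕ → Ω → ℝ} (hX : ∀ k, Measurable (X k)) {a : ℕ → Ω → ℕ}
    (ha : ∀ n, Measurable (a n)) (haind : IndepFun (fun ω n => a n ω) (fun ω k => X k ω) P)
    {v w : ℕ → ℝ} {l : EReal}
    (hcond : ∀ᵐ ω ∂P, limsupE (fun n => (a n ω : ℝ) / v n) < ⊤)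
    (hdet : ∀ b : ℕ → ℕ, limsupE (fun n => (b n : ℝ) / v n) < ⊤ →
      ∀ᵐ ω ∂P, limsupE (fun n => |partialSum X (n + b n) ω| / w n) = l) :
    ∀ᵐ ω ∂P, limsupE (fun n => |partialSum X (n + a n ω) ω| / w n) = l := by
  have hma : Measurable fun ω n => a n ω := measurable_pi_lambda _ ha
  have hmX : Measurable fun ω k => X k ω := measurable_pi_lambda _ hX
  have hsum : ∀ n, Measurable fun c : (ℕ → ℕ) × (ℕ → ℝ) =>
      |∑ k ∈ Finset.range (n + c.1 n), c.2 k| / w n := by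
    intro n
    have h1 : Measurable fun c : ℕ × (ℕ → ℝ) => ∑ k ∈ Finset.range (n + c.1), c.2 k :=
      measurable_from_prod_countable_right fun i =>
        show Measurable fun x : ℕ → ℝ => ∑ k ∈ Finset.range (n + i), x k from
          Finset.measurable_sum _ fun k _ => measurable_pi_apply k
    have h2 : Measurable fun c : (ℕ → ℕ) × (ℕ → ℝ) => (c.1 n, c.2) :=
      ((measurable_pi_apply n).comp measurable_fst).prodMk measurable_snd
    exact ((h1.comp h2).abs).div_const _
  have hE : MeasurableSet {c : (ℕ → ℕ) × (ℕ → ℝ) |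
      limsupE (fun n => |∑ k ∈ Finset.range (n + c.1 n), c.2 k| / w n) = l} :=
    measurable_limsupE hsum (measurableSet_singleton l)
  have hC : MeasurableSet {b : ℕ → ℕ | limsupE (fun n => (b n : ℝ) / v n) < ⊤} :=
    measurable_limsupE (fun n => (measurable_from_top.comp (measurable_pi_apply n)).div_const _)
      measurableSet_Iio
  -- By independence the joint law of lags and summands is a product, so it suffices to have the
  -- conclusion for almost every fixed lag sequence.
  have hprod := (indepFun_iff_map_prod_eq_prod_map_map hma.aemeasurable hmX.aemeasurable).1 haind
  have : IsProbabilityMeasure (P.map fun ω k => X k ω) :=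
    Measure.isProbabilityMeasure_map hmX.aemeasurable
  have : IsProbabilityMeasure (P.map fun ω n => a n ω) :=
    Measure.isProbabilityMeasure_map hma.aemeasurable
  have hb : ∀ᵐ b ∂(P.map fun ω n => a n ω), limsupE (fun n => (b n : ℝ) / v n) < ⊤ :=
    (ae_map_iff hma.aemeasurable hC).2 hcond
  have hae : ∀ᵐ c ∂((P.map fun ω n => a n ω).prod (P.map fun ω k => X k ω)),
      c ∈ {c : (ℕ → ℕ) × (ℕ → ℝ) |
        limsupE (fun n => |∑ k ∈ Finset.range (n + c.1 n), c.2 k| / w n) = l} := by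
    rw [Measure.ae_prod_mem_iff_ae_ae_mem hE]
    filter_upwards [hb] with b hb
    exact (ae_map_iff hmX.aemeasurable (measurable_prodMk_left hE)).2 (hdet b hb)
  rw [← hprod] at hae
  exact (ae_map_iff (hma.prodMk hmX).aemeasurable hE).1 hae

/-- Common form of all three regimes. Type `p` governs the norming; `hdet` keeps its count of the
same order under the lag and makes type `q` negligible in the convergence half; `hn` lets f be
compared along a geometric sequence in the divergence half. -/
theorem zeroInfinityLaw_of_bounds {Ω : Type*} [MeasurableSpace Ω] {P : Measure Ω}
    [IsProbabilityMeasure P] {X : ℕ → Ω → ℝ} {s : ℕ → Fin 2} {G : Fin 2 → ProbabilityMeasure ℝ}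
    {p q : Fin 2} {α α' c c' : ℝ} {d d' : ℕ → ℝ}
    (hX : ∀ k, Measurable (X k)) (hind : iIndepFun X P)
    (hlaw : ∀ k, P.map (X k) = (G (s k) : Measure ℝ)) (hpq : p ≠ q)
    (hα : 0 < α) (hα' : 0 < α') (hα2 : α < 2) (hα2' : α' < 2) (hc : 0 < c)
    (hG : InDomainOfNormalAttraction (G p) α c d) (hG' : InDomainOfNormalAttraction (G q) α' c' d')
    (hd : α ≠ 1 → ∀ n, d n = 0) (hd' : α' ≠ 1 → ∀ n, d' n = 0)
    {f : ℝ → ℝ} (hfpos : ∀ x, 1 ≤ x → 0 < f x) (hfmono : MonotoneOn f (Set.Ici 1))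
    (hτ : Tendsto (tau s p) atTop atTop)
    {a : ℕ → Ω → ℕ} (ha : ∀ n, Measurable (a n))
    (haind : IndepFun (fun ω n => a n ω) (fun ω k => X k ω) P) {v : ℕ → ℝ}
    (hcond : ∀ᵐ ω ∂P, limsupE (fun n => (a n ω : ℝ) / v n) < ⊤)
    {μ : ℝ} (hμ : 0 ≤ μ) (hμα : 1 < μ + α' / α)
    (hdet : ∀ b : ℕ → ℕ, limsupE (fun n => (b n : ℝ) / v n) < ⊤ → ∃ D : ℝ, 0 < D ∧
      (∀ᶠ n : ℕ in atTop, (tau s p (n + b n) : ℝ) ≤ D * tau s p n) ∧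
      ∀ᶠ n : ℕ in atTop, (tau s q (n + b n) : ℝ) ≤
        D * (tau s p n : ℝ) ^ (α' / α) * Real.log (tau s p n) ^ (-μ))
    (hn : ∃ D r : ℝ, ∀ᶠ n : ℕ in atTop, (n : ℝ) ≤ D * (tau s p n : ℝ) ^ r)
    {B : ℕ → ℝ} (hB : ∃ c₁ c₂ : ℝ, 0 < c₁ ∧ 0 < c₂ ∧ ∀ᶠ n : ℕ in atTop,
      c₁ * (tau s p n : ℝ) ^ (1 / α) ≤ B n ∧ B n ≤ c₂ * (tau s p n : ℝ) ^ (1 / α)) :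
    ZeroInfinityLaw P X a B f α := by
  obtain ⟨c₁, c₂, hc₁, hc₂, hB⟩ := hB
  have hmean : ∀ {G : ProbabilityMeasure ℝ} {α c : ℝ} {d : ℕ → ℝ}, α < 2 →
      InDomainOfNormalAttraction G α c d → (α ≠ 1 → ∀ n, d n = 0) → 1 < α →
      ∫ z, z ∂(G : Measure ℝ) = 0 := fun h2 hG hd h1 => hG.integral_eq_zero h1 h2 (hd h1.ne')
  constructor
  · intro hlog
    obtain ⟨C, κ, hC, hκ, hSB⟩ := exists_sumBound hα2 (hG.tail_le hα) (hmean hα2 hG hd)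
    obtain ⟨C', κ', hC', hκ', hSB'⟩ := exists_sumBound hα2' (hG'.tail_le hα') (hmean hα2' hG' hd')
    refine ae_limsupE_random_lag hX ha haind hcond fun b hb => ?_
    obtain ⟨D, hD, h1, h2⟩ := hdet b hb
    exact ae_limsupE_eq_zero hX hind hlaw hpq hα hα' hC.le hC'.le hκ hκ' hSB hSB' hfpos hfmono hlog
      hτ hD hμ hμα h1 h2 hc₁ (hB.mono fun n h => h.1)
  · intro hlog
    refine ae_limsupE_random_lag hX ha haind hcond fun b hb => ?_
    obtain ⟨D, -, h1, -⟩ := hdet b hb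
    obtain ⟨E, r, hn⟩ := hn
    -- An integer exponent strictly above `r` also absorbs the constant `E` eventually.
    obtain ⟨κ, hκ⟩ := exists_nat_gt |r|
    have hκ0 : κ ≠ 0 := by
      rintro rfl
      have := abs_nonneg r
      simp only [CharP.cast_eq_zero] at hκ
      linarith
    refine ae_limsupE_eq_top hX hind hlaw hα (hG.tail_le hα) (hG.le_tail hα hα2 hc) hfpos hfmono
      hlog hτ h1 hκ0 ?_ hc₂ ?_
    · have hpow : Tendsto (fun n => (tau s p n : ℝ) ^ (κ - r)) atTop atTop :=
        (tendsto_natCast_rpow_atTop (by linarith [le_abs_self r])).comp hτ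
      filter_upwards [hn, hpow.eventually_ge_atTop E, hτ.eventually_ge_atTop 1] with n h3 h4 h5
      have ht0 : (0 : ℝ) < tau s p n := by exact_mod_cast h5
      have h6 : (n : ℝ) ≤ (tau s p n : ℝ) ^ κ := by
        calc (n : ℝ) ≤ E * (tau s p n : ℝ) ^ r := h3
          _ ≤ (tau s p n : ℝ) ^ (κ - r) * (tau s p n : ℝ) ^ r := by gcongr
          _ = _ := by rw [← Real.rpow_add ht0, sub_add_cancel, Real.rpow_natCast]
      exact_mod_cast h6
    · filter_upwards [hB, hτ.eventually_ge_atTop 1] with n h3 h4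
      have ht0 : (0 : ℝ) < tau s p n := by exact_mod_cast h4
      exact ⟨lt_of_lt_of_le (by positivity) h3.1, h3.2⟩

/-! ### Growth of the type counts under the lags -/

theorem exists_eventually_le_of_limsupE_lt_top {b : ℕ → ℕ} {v : ℕ → ℝ} (hv : ∀ᶠ n in atTop, 0 < v n)
    (h : limsupE (fun n => (b n : ℝ) / v n) < ⊤) :
    ∃ C : ℝ, 0 < C ∧ ∀ᶠ n in atTop, (b n : ℝ) ≤ C * v n := by
  obtain ⟨y, hy, -⟩ := EReal.lt_iff_exists_real_btwn.1 h
  refine ⟨|y| + 1, by positivity, ?_⟩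
  filter_upwards [eventually_lt_of_limsup_lt hy, hv] with n hn hvn
  have h1 := (EReal.coe_lt_coe_iff.1 hn).le
  rw [div_le_iff₀ hvn] at h1
  refine h1.trans (mul_le_mul_of_nonneg_right ?_ hvn.le)
  linarith [le_abs_self y]

theorem SameOrder.exists_bounds {u v : ℕ → ℝ} (hv : ∀ᶠ n in atTop, 0 < v n) (h : SameOrder u v) :
    ∃ c₁ c₂ : ℝ, 0 < c₁ ∧ 0 < c₂ ∧ ∀ᶠ n in atTop, c₁ * v n ≤ u n ∧ u n ≤ c₂ * v n := by
  obtain ⟨C, hC, hlim⟩ := h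
  refine ⟨C / 2, 2 * C, by positivity, by positivity, ?_⟩
  filter_upwards [hv, hlim.eventually_const_le (show C / 2 < C by linarith),
    hlim.eventually_le_const (show C < 2 * C by linarith)] with n h0 h1 h2
  exact ⟨(le_div_iff₀ h0).1 h1, (div_le_iff₀ h0).1 h2⟩

theorem tau_add_le (s : ℕ → Fin 2) (j : Fin 2) (n k : ℕ) : tau s j (n + k) ≤ tau s j n + k := by
  induction k with
  | zero => simp
  | succ k ih =>
    have := tau_succ_le s j (n + k)
    rw [← add_assoc]
    omega

theorem le_mul_rpow_of_rpow_le {x y K r t : ℝ} (hx : 0 ≤ x) (hy : 0 ≤ y) (hK : 0 ≤ K) (hr : 0 < r)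
    (h : x ^ r ≤ K * y ^ t) : x ≤ K ^ (1 / r) * y ^ (t / r) := by
  calc x = (x ^ r) ^ (1 / r) := by rw [← Real.rpow_mul hx, mul_one_div_cancel hr.ne', Real.rpow_one]
    _ ≤ (K * y ^ t) ^ (1 / r) := Real.rpow_le_rpow (by positivity) h (by positivity)
    _ = _ := by
      rw [Real.mul_rpow hK (by positivity), ← Real.rpow_mul hy, mul_one_div]

section Ratio

variable {t₁ t₂ : ℕ → ℕ} {α₁ α₂ : ℝ} {lam : ℝ≥0∞}

theorem exists_le_mul_rpow_of_lt_top (hα₂ : 0 < α₂) (h₂ : Tendsto t₂ atTop atTop)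
    (hlam : Tendsto (fun n => ENNReal.ofReal ((t₁ n : ℝ) ^ α₂ / (t₂ n : ℝ) ^ α₁)) atTop (𝓝 lam))
    (h : lam < ⊤) :
    ∃ K : ℝ, 0 < K ∧ ∀ᶠ n in atTop, (t₁ n : ℝ) ≤ K * (t₂ n : ℝ) ^ (α₁ / α₂) := by
  refine ⟨(lam.toReal + 1) ^ (1 / α₂), by positivity, ?_⟩
  have h1 : lam < ENNReal.ofReal (lam.toReal + 1) := by
    rw [ENNReal.lt_ofReal_iff_toReal_lt h.ne]
    linarith
  filter_upwards [hlam.eventually_lt_const h1, h₂.eventually_ge_atTop 1] with n hn hn2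
  have ht : (0 : ℝ) < t₂ n := by exact_mod_cast hn2
  have h3 := (ENNReal.ofReal_lt_ofReal_iff (by positivity)).1 hn
  rw [div_lt_iff₀ (by positivity)] at h3
  exact le_mul_rpow_of_rpow_le (by positivity) ht.le (by positivity) hα₂ h3.le

theorem exists_le_mul_rpow_of_pos (hα₁ : 0 < α₁) (h₂ : Tendsto t₂ atTop atTop)
    (hlam : Tendsto (fun n => ENNReal.ofReal ((t₁ n : ℝ) ^ α₂ / (t₂ n : ℝ) ^ α₁)) atTop (𝓝 lam))
    (h : 0 < lam) :
    ∃ K : ℝ, 0 < K ∧ ∀ᶠ n in atTop, (t₂ n : ℝ) ≤ K * (t₁ n : ℝ) ^ (α₂ / α₁) := by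
  obtain ⟨r, hr0, hr⟩ := ENNReal.lt_iff_exists_nnreal_btwn.1 h
  have hr0' : (0 : ℝ) < r := by exact_mod_cast hr0
  refine ⟨((r : ℝ)⁻¹) ^ (1 / α₁), by positivity, ?_⟩
  filter_upwards [hlam.eventually_const_lt hr, h₂.eventually_ge_atTop 1] with n hn hn2
  have ht : (0 : ℝ) < t₂ n := by exact_mod_cast hn2
  rw [← ENNReal.ofReal_coe_nnreal] at hn
  have h3 := (ENNReal.ofReal_lt_ofReal_iff_of_nonneg r.coe_nonneg).1 hn
  rw [lt_div_iff₀ (by positivity)] at h3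
  refine le_mul_rpow_of_rpow_le ht.le (by positivity) (by positivity) hα₁ ?_
  rw [← div_eq_inv_mul, le_div_iff₀ hr0', mul_comm]
  exact h3.le

end Ratio

section Lags

variable {s : ℕ → Fin 2} {α₁ α₂ : ℝ}

/-- If the ratio is bounded, almost all summands are of the second type. -/
theorem exists_le_mul_tau_one (hα₁ : 0 < α₁) (hα₁₂ : α₁ < α₂)
    (h₂ : Tendsto (tau s 1) atTop atTop) {K : ℝ} (hK : 0 < K)
    (h : ∀ᶠ n in atTop, (tau s 0 n : ℝ) ≤ K * (tau s 1 n : ℝ) ^ (α₁ / α₂)) :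
    ∀ᶠ n : ℕ in atTop, (n : ℝ) ≤ (K + 1) * tau s 1 n := by
  filter_upwards [h, h₂.eventually_ge_atTop 1] with n h1 h2
  have ht : (1 : ℝ) ≤ tau s 1 n := by exact_mod_cast h2
  have h3 : (tau s 1 n : ℝ) ^ (α₁ / α₂) ≤ tau s 1 n :=
    Real.rpow_le_self_of_one_le ht ((div_lt_one (hα₁.trans hα₁₂)).2 hα₁₂).le
  have h4 : (n : ℝ) = tau s 0 n + tau s 1 n := by
    exact_mod_cast (tau_add_tau s (p := 0) (q := 1) (by decide) n).symm
  have := mul_le_mul_of_nonneg_left h3 hK.le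
  linarith

/-- Here n + b_n = O(n) = O(τ₂(n)) = O(τ₁(n)^(α₂/α₁)). The opposite comparison, used at the index n
+ b_n, brings this back to τ₁(n + b_n) = O(τ₁(n)). -/
theorem exists_lag_bounds_of_pos_of_lt_top (hα₁ : 0 < α₁) (hα₁₂ : α₁ < α₂)
    (h₂ : Tendsto (tau s 1) atTop atTop) {K K' : ℝ} (hK : 0 < K) (hK' : 0 < K')
    (h : ∀ᶠ n in atTop, (tau s 0 n : ℝ) ≤ K * (tau s 1 n : ℝ) ^ (α₁ / α₂))
    (h' : ∀ᶠ n in atTop, (tau s 1 n : ℝ) ≤ K' * (tau s 0 n : ℝ) ^ (α₂ / α₁))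
    {b : ℕ → ℕ} {C : ℝ} (hC : 0 < C) (hb : ∀ᶠ n : ℕ in atTop, (b n : ℝ) ≤ C * n) :
    ∃ D : ℝ, 0 < D ∧
      (∀ᶠ n : ℕ in atTop, (tau s 0 (n + b n) : ℝ) ≤ D * tau s 0 n) ∧
      ∀ᶠ n : ℕ in atTop, (tau s 1 (n + b n) : ℝ) ≤
        D * (tau s 0 n : ℝ) ^ (α₂ / α₁) * Real.log (tau s 0 n) ^ (-0 : ℝ) := by
  have hα₂ : 0 < α₂ := hα₁.trans hα₁₂
  set E := (1 + C) * (K + 1) * K' with hE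
  have hE0 : 0 < E := by positivity
  have hnb : ∀ᶠ n : ℕ in atTop, (n + b n : ℝ) ≤ E * (tau s 0 n : ℝ) ^ (α₂ / α₁) := by
    filter_upwards [hb, h', exists_le_mul_tau_one hα₁ hα₁₂ h₂ hK h] with n h1 h3 h4
    calc (n + b n : ℝ) ≤ (1 + C) * n := by linarith
      _ ≤ (1 + C) * ((K + 1) * tau s 1 n) := by gcongr
      _ ≤ (1 + C) * ((K + 1) * (K' * (tau s 0 n : ℝ) ^ (α₂ / α₁))) := by gcongr
      _ = _ := by ring
  refine ⟨max (K * E ^ (α₁ / α₂)) E, by positivity, ?_, ?_⟩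
  · have hadd : Tendsto (fun n => n + b n) atTop atTop :=
      tendsto_atTop_mono (fun n => Nat.le_add_right n (b n)) tendsto_id
    filter_upwards [hnb, hadd.eventually h] with n h1 h3
    have h4 : (tau s 1 (n + b n) : ℝ) ≤ E * (tau s 0 n : ℝ) ^ (α₂ / α₁) := by
      refine le_trans ?_ h1
      exact_mod_cast tau_le s 1 (n + b n)
    calc (tau s 0 (n + b n) : ℝ) ≤ K * (tau s 1 (n + b n) : ℝ) ^ (α₁ / α₂) := h3
      _ ≤ K * (E * (tau s 0 n : ℝ) ^ (α₂ / α₁)) ^ (α₁ / α₂) := by gcongr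
      _ = K * E ^ (α₁ / α₂) * tau s 0 n := by
          rw [Real.mul_rpow hE0.le (by positivity), ← Real.rpow_mul (by positivity),
            div_mul_div_cancel₀ hα₁.ne', div_self hα₂.ne', Real.rpow_one, mul_assoc]
      _ ≤ _ := mul_le_mul_of_nonneg_right (le_max_left _ _) (Nat.cast_nonneg _)
  · filter_upwards [hnb] with n h1
    rw [neg_zero, Real.rpow_zero, mul_one]
    refine le_trans (by exact_mod_cast tau_le s 1 (n + b n)) (h1.trans ?_)
    exact mul_le_mul_of_nonneg_right (le_max_right _ _) (by positivity)

/-- The lag adds at most O(τ₁(n)) to either count, which is harmless because α₂/α₁ > 1. -/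
theorem exists_lag_bounds_of_eq_top (hα₁ : 0 < α₁) (hα₁₂ : α₁ < α₂)
    (h₁ : Tendsto (tau s 0) atTop atTop) {K : ℝ} (hK : 0 < K)
    (h : ∀ᶠ n in atTop, (tau s 1 n : ℝ) ≤ K * (tau s 0 n : ℝ) ^ (α₂ / α₁))
    {b : ℕ → ℕ} {C : ℝ} (hC : 0 < C) (hb : ∀ᶠ n : ℕ in atTop, (b n : ℝ) ≤ C * tau s 0 n) :
    ∃ D : ℝ, 0 < D ∧
      (∀ᶠ n : ℕ in atTop, (tau s 0 (n + b n) : ℝ) ≤ D * tau s 0 n) ∧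
      ∀ᶠ n : ℕ in atTop, (tau s 1 (n + b n) : ℝ) ≤
        D * (tau s 0 n : ℝ) ^ (α₂ / α₁) * Real.log (tau s 0 n) ^ (-0 : ℝ) := by
  have hadd : ∀ j n, (tau s j (n + b n) : ℝ) ≤ tau s j n + b n := fun j n => by
    exact_mod_cast tau_add_le s j n (b n)
  refine ⟨1 + C + K, by positivity, ?_, ?_⟩
  · filter_upwards [hb] with n h2
    have h4 : 0 ≤ K * tau s 0 n := by positivity
    linarith [hadd 0 n]
  · filter_upwards [hb, h, h₁.eventually_ge_atTop 1] with n h2 h3 h4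
    have ht : (1 : ℝ) ≤ tau s 0 n := by exact_mod_cast h4
    have h5 : (tau s 0 n : ℝ) ≤ (tau s 0 n : ℝ) ^ (α₂ / α₁) :=
      Real.self_le_rpow_of_one_le ht ((one_lt_div hα₁).2 hα₁₂).le
    rw [neg_zero, Real.rpow_zero, mul_one]
    have h6 := mul_le_mul_of_nonneg_left h5 hC.le
    have h7 : 0 ≤ (tau s 0 n : ℝ) ^ (α₂ / α₁) := by positivity
    linarith [hadd 1 n]

/-- The sparsity condition on the first type is used at the shifted index n + b_n, which is O(τ₂(n))
and at least τ₂(n). The first fact bounds the power, the second the logarithm. -/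
theorem exists_lag_bounds_of_eq_zero (hα₁ : 0 < α₁) (hα₁₂ : α₁ < α₂)
    (h₂ : Tendsto (tau s 1) atTop atTop) {K : ℝ} (hK : 0 < K)
    (h : ∀ᶠ n in atTop, (tau s 0 n : ℝ) ≤ K * (tau s 1 n : ℝ) ^ (α₁ / α₂)) {μ : ℝ} (hμ : 0 ≤ μ)
    (hC₃ : ∀ᶠ n : ℕ in atTop, (tau s 0 n : ℝ) < (n : ℝ) ^ (α₁ / α₂) * Real.log (n : ℝ) ^ (-μ))
    {b : ℕ → ℕ} {C : ℝ} (hC : 0 < C) (hb : ∀ᶠ n : ℕ in atTop, (b n : ℝ) ≤ C * n) :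
    ∃ D : ℝ, 0 < D ∧
      (∀ᶠ n : ℕ in atTop, (tau s 1 (n + b n) : ℝ) ≤ D * tau s 1 n) ∧
      ∀ᶠ n : ℕ in atTop, (tau s 0 (n + b n) : ℝ) ≤
        D * (tau s 1 n : ℝ) ^ (α₁ / α₂) * Real.log (tau s 1 n) ^ (-μ) := by
  have hα₂ : 0 < α₂ := hα₁.trans hα₁₂
  set E := (1 + C) * (K + 1) with hE
  have hE0 : 0 < E := by positivity
  have hnb : ∀ᶠ n : ℕ in atTop, ((n + b n : ℕ) : ℝ) ≤ E * tau s 1 n := by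
    filter_upwards [hb, exists_le_mul_tau_one hα₁ hα₁₂ h₂ hK h] with n h1 h3
    push_cast
    calc (n + b n : ℝ) ≤ (1 + C) * n := by linarith
      _ ≤ (1 + C) * ((K + 1) * tau s 1 n) := by gcongr
      _ = _ := by ring
  refine ⟨max E (E ^ (α₁ / α₂)), by positivity, ?_, ?_⟩
  · filter_upwards [hnb] with n h1
    refine le_trans (by exact_mod_cast tau_le s 1 (n + b n)) (h1.trans ?_)
    exact mul_le_mul_of_nonneg_right (le_max_left _ _) (Nat.cast_nonneg _)
  · have hadd : Tendsto (fun n => n + b n) atTop atTop :=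
      tendsto_atTop_mono (fun n => Nat.le_add_right n (b n)) tendsto_id
    filter_upwards [hnb, hadd.eventually hC₃, h₂.eventually_ge_atTop 2] with n h1 h3 h4
    have ht : (2 : ℝ) ≤ tau s 1 n := by exact_mod_cast h4
    have hlog : 0 < Real.log (tau s 1 n) := Real.log_pos (by linarith)
    have h5 : (tau s 1 n : ℝ) ≤ (n + b n : ℕ) := by
      exact_mod_cast (tau_le s 1 n).trans (Nat.le_add_right _ _)
    have h6 : Real.log (n + b n : ℕ) ^ (-μ) ≤ Real.log (tau s 1 n) ^ (-μ) :=
      Real.rpow_le_rpow_of_nonpos hlog (Real.log_le_log (by linarith) h5) (by linarith)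
    calc (tau s 0 (n + b n) : ℝ)
        ≤ ((n + b n : ℕ) : ℝ) ^ (α₁ / α₂) * Real.log (n + b n : ℕ) ^ (-μ) := h3.le
      _ ≤ (E * tau s 1 n) ^ (α₁ / α₂) * Real.log (tau s 1 n) ^ (-μ) := by gcongr
      _ = E ^ (α₁ / α₂) * (tau s 1 n : ℝ) ^ (α₁ / α₂) * Real.log (tau s 1 n) ^ (-μ) := by
          rw [Real.mul_rpow hE0.le (by positivity)]
      _ ≤ _ := by
          have := le_max_right E (E ^ (α₁ / α₂))
          gcongr

end Lags

end DelayedSums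

/-! ### The three regimes of λ -/

theorem mainTheorem5
    {Ω : Type*} [MeasurableSpace Ω] (P : Measure Ω) [IsProbabilityMeasure P]
    -- the two distributions, in domains of normal attraction of stable laws
    (α₁ α₂ c₁ c₂ : ℝ) (hα₁ : 0 < α₁) (hα₁₂ : α₁ < α₂) (hα₂ : α₂ < 2)
    (hc₁ : 0 < c₁) (hc₂ : 0 < c₂)
    (G₁ G₂ : ProbabilityMeasure ℝ) (d₁ d₂ : ℕ → ℝ)
    (hG₁ : DelayedSums.InDomainOfNormalAttraction G₁ α₁ c₁ d₁)
    (hG₂ : DelayedSums.InDomainOfNormalAttraction G₂ α₂ c₂ d₂)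
    (hd₁ : α₁ ≠ 1 → ∀ n, d₁ n = 0) (hd₂ : α₂ ≠ 1 → ∀ n, d₂ n = 0)
    -- the summands: type `0` has law `G₁`, type `1` has law `G₂`
    (s : ℕ → Fin 2) (X : ℕ → Ω → ℝ) (hX : ∀ k, Measurable (X k)) (hXind : iIndepFun X P)
    (hXlaw₁ : ∀ k, s k = 0 → P.map (X k) = (G₁ : Measure ℝ))
    (hXlaw₂ : ∀ k, s k = 1 → P.map (X k) = (G₂ : Measure ℝ))
    (τ₁ τ₂ : ℕ → ℕ) (hτ₁ : τ₁ = DelayedSums.tau s 0) (hτ₂ : τ₂ = DelayedSums.tau s 1)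
    (hτ₁top : Tendsto τ₁ atTop atTop) (hτ₂top : Tendsto τ₂ atTop atTop)
    -- the limit `lam ∈ [0, ∞]` of the ratio, and the norming sequence
    (lam : ℝ≥0∞)
    (hlam : Tendsto (fun n => ENNReal.ofReal ((τ₁ n : ℝ) ^ α₂ / (τ₂ n : ℝ) ^ α₁)) atTop (𝓝 lam))
    (B : ℕ → ℝ)
    (hBtop : lam = ⊤ → DelayedSums.SameOrder B (fun n => (τ₁ n : ℝ) ^ (1 / α₁)))
    (hBfin : lam < ⊤ → DelayedSums.SameOrder B (fun n => (τ₂ n : ℝ) ^ (1 / α₂)))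
    -- the function `f`
    (f : ℝ → ℝ) (hfpos : ∀ x, 1 ≤ x → 0 < f x) (hfmono : MonotoneOn f (Set.Ici 1))
    (hf : ∀ b : ℕ → ℕ, (∀ n, 1 ≤ b n) →
      DelayedSums.limsupE (fun n => (b n : ℝ) / (n : ℝ)) < ⊤ →
      DelayedSums.limsupE (fun n => f (b n : ℝ) / f (n : ℝ)) < ⊤)
    -- the random lags
    (a : ℕ → Ω → ℕ) (ha : ∀ n, Measurable (a n)) (hapos : ∀ n ω, 1 ≤ a n ω)
    (haind : IndepFun (fun ω n => a n ω) (fun ω k => X k ω) P) :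
    (0 < lam → lam < ⊤ →
      (∀ᵐ ω ∂P, DelayedSums.limsupE (fun n => (a n ω : ℝ) / (n : ℝ)) < ⊤) →
      DelayedSums.ZeroInfinityLaw P X a B f α₁) ∧
    (lam = ⊤ →
      (∀ᵐ ω ∂P, DelayedSums.limsupE (fun n => (a n ω : ℝ) / (τ₁ n : ℝ)) < ⊤) →
      DelayedSums.ZeroInfinityLaw P X a B f α₁) ∧
    (lam = 0 →
      (∀ᵐ ω ∂P, DelayedSums.limsupE (fun n => (a n ω : ℝ) / (n : ℝ)) < ⊤) →
      (∃ m : ℝ, (α₂ - α₁) / α₂ < m ∧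
        ∀ᶠ n : ℕ in atTop, (τ₁ n : ℝ) < (n : ℝ) ^ (α₁ / α₂) * Real.log (n : ℝ) ^ (-m)) →
      DelayedSums.ZeroInfinityLaw P X a B f α₂) := by
  open DelayedSums in
  subst hτ₁ hτ₂
  have hα₂0 : 0 < α₂ := hα₁.trans hα₁₂
  have hα₁2 : α₁ < 2 := hα₁₂.trans hα₂
  have hratio : 1 < α₂ / α₁ := (one_lt_div hα₁).2 hα₁₂
  let G : Fin 2 → ProbabilityMeasure ℝ := ![G₁, G₂]
  have hlaw : ∀ k, P.map (X k) = (G (s k) : Measure ℝ) := by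
    intro k
    rcases Fin.exists_fin_two.1 ⟨s k, rfl⟩ with h | h
    · rw [h]
      exact hXlaw₁ k h
    · rw [h]
      exact hXlaw₂ k h
  have hnpos : ∀ᶠ n : ℕ in atTop, (0 : ℝ) < n := by
    filter_upwards [eventually_gt_atTop 0] with n hn
    exact_mod_cast hn
  have hτpos : ∀ j, Tendsto (tau s j) atTop atTop → ∀ᶠ n in atTop, (0 : ℝ) < tau s j n := by
    intro j hj
    filter_upwards [hj.eventually_gt_atTop 0] with n hn
    exact_mod_cast hn
  have hpos₁ := hτpos 0 hτ₁top
  have hpos₂ := hτpos 1 hτ₂top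
  refine ⟨fun h0 htop hcond => ?_, fun htop hcond => ?_, fun h0 hcond hC₃ => ?_⟩
  · obtain ⟨K, hK, hle⟩ := exists_le_mul_rpow_of_lt_top hα₂0 hτ₂top hlam htop
    obtain ⟨K', hK', hle'⟩ := exists_le_mul_rpow_of_pos hα₁ hτ₂top hlam h0
    refine zeroInfinityLaw_of_bounds (G := G) (p := 0) (q := 1) (μ := 0) hX hXind hlaw (by decide)
      hα₁ hα₂0 hα₁2 hα₂ hc₁ hG₁ hG₂ hd₁ hd₂ hfpos hfmono hτ₁top ha haind hcond le_rfl
      (by rwa [zero_add]) (fun b hb => ?_) ⟨(K + 1) * K', α₂ / α₁, ?_⟩ ?_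
    · obtain ⟨C, hC, hb⟩ := exists_eventually_le_of_limsupE_lt_top hnpos hb
      exact exists_lag_bounds_of_pos_of_lt_top hα₁ hα₁₂ hτ₂top hK hK' hle hle' hC hb
    · filter_upwards [exists_le_mul_tau_one hα₁ hα₁₂ hτ₂top hK hle, hle'] with n h1 h2
      calc (n : ℝ) ≤ (K + 1) * tau s 1 n := h1
        _ ≤ (K + 1) * (K' * (tau s 0 n : ℝ) ^ (α₂ / α₁)) := by gcongr
        _ = _ := by ring
    · obtain ⟨c, c', hc, hc', hB⟩ := (hBfin htop).exists_bounds
        (hpos₂.mono fun n hn => Real.rpow_pos_of_pos hn _)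
      -- For 0 < λ < ∞ the sequence B is given relative to τ₂^(1/α₂). This has the same order as
      -- τ₁^(1/α₁), so the first type may serve as the governing one.
      refine ⟨c / K ^ (1 / α₁), c' * K' ^ (1 / α₂), by positivity, by positivity, ?_⟩
      filter_upwards [hB, hle, hle'] with n hBn h1 h2
      have h3 : (tau s 0 n : ℝ) ^ (1 / α₁) ≤ K ^ (1 / α₁) * (tau s 1 n : ℝ) ^ (1 / α₂) := by
        calc _ ≤ (K * (tau s 1 n : ℝ) ^ (α₁ / α₂)) ^ (1 / α₁) := by gcongr
          _ = _ := by
            rw [Real.mul_rpow hK.le (by positivity), ← Real.rpow_mul (by positivity)]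
            congr 2
            field_simp
      have h4 : (tau s 1 n : ℝ) ^ (1 / α₂) ≤ K' ^ (1 / α₂) * (tau s 0 n : ℝ) ^ (1 / α₁) := by
        calc _ ≤ (K' * (tau s 0 n : ℝ) ^ (α₂ / α₁)) ^ (1 / α₂) := by gcongr
          _ = _ := by
            rw [Real.mul_rpow hK'.le (by positivity), ← Real.rpow_mul (by positivity)]
            congr 2
            field_simp
      refine ⟨le_trans ?_ hBn.1, hBn.2.trans ?_⟩
      · rw [div_mul_eq_mul_div, div_le_iff₀ (by positivity)]
        have := mul_le_mul_of_nonneg_left h3 hc.le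
        linarith
      · have := mul_le_mul_of_nonneg_left h4 hc'.le
        linarith
  · obtain ⟨K, hK, hle⟩ := exists_le_mul_rpow_of_pos hα₁ hτ₂top hlam (by simp [htop])
    refine zeroInfinityLaw_of_bounds (G := G) (p := 0) (q := 1) (μ := 0) hX hXind hlaw (by decide)
      hα₁ hα₂0 hα₁2 hα₂ hc₁ hG₁ hG₂ hd₁ hd₂ hfpos hfmono hτ₁top ha haind hcond le_rfl
      (by rwa [zero_add]) (fun b hb => ?_) ⟨1 + K, α₂ / α₁, ?_⟩ ?_
    · obtain ⟨C, hC, hb⟩ := exists_eventually_le_of_limsupE_lt_top hpos₁ hb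
      exact exists_lag_bounds_of_eq_top hα₁ hα₁₂ hτ₁top hK hle hC hb
    · filter_upwards [hle, hτ₁top.eventually_ge_atTop 1] with n h1 h2
      have ht : (1 : ℝ) ≤ tau s 0 n := by exact_mod_cast h2
      have h3 : (tau s 0 n : ℝ) ≤ (tau s 0 n : ℝ) ^ (α₂ / α₁) :=
        Real.self_le_rpow_of_one_le ht hratio.le
      have h4 : (n : ℝ) = tau s 0 n + tau s 1 n := by
        exact_mod_cast (tau_add_tau s (p := 0) (q := 1) (by decide) n).symm
      linarith
    · exact (hBtop htop).exists_bounds (hpos₁.mono fun n hn => Real.rpow_pos_of_pos hn _)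
  · obtain ⟨K, hK, hle⟩ := exists_le_mul_rpow_of_lt_top hα₂0 hτ₂top hlam (by simp [h0])
    obtain ⟨μ, hμ, hC₃⟩ := hC₃
    have hμ0 : 0 ≤ μ := le_trans (div_nonneg (by linarith) hα₂0.le) hμ.le
    -- The threshold (α₂ - α₁)/α₂ in (C₃) is exactly what makes k^(-(μ + α₁/α₂)) summable.
    have hμ1 : 1 < μ + α₁ / α₂ := by
      rw [sub_div, div_self hα₂0.ne'] at hμ
      linarith
    -- For λ = 0 the types exchange roles, and the exponent ratio α₁/α₂ is below 1.
    refine zeroInfinityLaw_of_bounds (G := G) (p := 1) (q := 0) (μ := μ) hX hXind hlaw (by decide)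
      hα₂0 hα₁ hα₂ hα₁2 hc₂ hG₂ hG₁ hd₂ hd₁ hfpos hfmono hτ₂top ha haind hcond hμ0 hμ1
      (fun b hb => ?_) ⟨K + 1, 1, ?_⟩ ?_
    · obtain ⟨C, hC, hb⟩ := exists_eventually_le_of_limsupE_lt_top hnpos hb
      exact exists_lag_bounds_of_eq_zero hα₁ hα₁₂ hτ₂top hK hle hμ0 hC₃ hC hb
    · simpa only [Real.rpow_one] using exists_le_mul_tau_one hα₁ hα₁₂ hτ₂top hK hle
    · exact (hBfin (by simp [h0])).exists_bounds
        (hpos₂.mono fun n hn => Real.rpow_pos_of_pos hn _)
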